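/- Let $G=(V,E)$ be a finite directed graph with $n=|V|$ totally ordered vertices (vertex ids), and let $M$ be a diffusion process on $G$: either independent cascade with edge probabilities $p_u(v)\in[0,1]$, or linear threshold with non-negative edge weights of total incoming weight at most $1$ at each vertex and independent thresholds uniform on $[0,1]$. For $S\subseteq V$ let $\sigma(S)$ be the expected number of vertices that are finally active when the process starts from $S$, and $OPT=\max_{|S|\le k}\sigma(S)$, where $1\le k\le n/2$. Let $m\ge 1$, $0<\delta<1/2$, $\varepsilon>0$, $0<\eta<1$, and $$\rho=\frac{(1-1/e)(1/2-\delta)}{(1-1/e)+(1/2-\delta)} .$$ *Samples.* A random reverse reachable (RRR) set is obtained by choosing a uniformly random $u\in V$ and a random live-edge subgraph $g$, and consists of the vertices from which $u$ is reachable in $g$. In $g$, the edges are kept independently with probabilities $p$ (independent cascade), or each vertex keeps at most one incoming edge, chosen with probability equal to its weight (linear threshold). For a list $\mathfrak R=(\mathcal R(0),\dots,\mathcal R(\theta-1))$ of samples put $\mathcal S(v)=\{i: v\in \mathcal R(i)\}$ and $C(S)=|\bigcup_{v\in S}\mathcal S(v)|$. *Seed selection from $\mathfrak R$.* Each vertex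 is assigned independently and uniformly at random to one of $m$ machines. Each machine runs the greedy algorithm for max-$k$-cover on its own vertices (ties broken by the smallest id; stopping early only if its vertices are exhausted). All local seeds are sent, in an arbitrary order of arrival, to a receiver, which runs the following one-pass streaming algorithm. Let $l$ be the largest $|\mathcal S(v)|$ in the stream; there are $\max(1,\lceil\log_{1+\delta}k\rceil)$ buckets $b=0,1,\dots$, and bucket $b$ accepts an arriving vertex $v$ if it holds fewer than $k$ vertices and $v$ covers at least $l(1+\delta)^b/(2k)$ samples not yet covered by the bucket; the bucket of largest coverage is the global solution. The output is the better one, with respect to $C$, of the global solution and the best local solution. *IMM sampling.* For $\eta'\in(0,1)$ put $\lambda^*(\eta')=2n\varepsilon^{-2}\Bigl((1-\tfrac1e)\sqrt{\ln\tfrac2{\eta'}}+\sqrt{(1-\tfrac1e)\bigl(\ln\tbinom nk+\ln\tfrac2{\eta'}\bigr)}\Bigr)^2$. Further put $\varepsilon'=\sqrt2\,\varepsilon$ and $\lambda'=(2+\tfrac23\varepsilon')\bigl(\ln\tbinom nk+\ln\tfrac2\eta+\ln\log_2 n\bigr)n/\varepsilon'^2$. In rounds $i=1,\dots,\lfloor\log_2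 n\rfloor$ the number of RRR samples is increased to $2^{i-1}\lceil 2\lambda'/n\rceil$ (earlier samples are kept) and a set $S_i$ is selected from all the samples by the seed selection above, with a fresh partition. If the estimate $n\,C(S_i)/|\mathfrak R|$ is at least $(1+\varepsilon')n/2^i$, then $LB=n\,C(S_i)/\bigl(|\mathfrak R|(1+\varepsilon')\bigr)$ and the rounds stop; if this never happens, $LB=1$. Finally $\lceil\lambda^*(\eta/2)/LB\rceil$ fresh RRR samples are drawn, and the seed selection applied to them, with a fresh partition, gives the output $S$. This is GreediRIS with streaming aggregation. Then GreediRIS is a $(\rho-\varepsilon)$-approximation for influence maximization, in expectation. Precisely: 1. (Given enough samples.) If $\theta\ge\lambda^*(\eta)/OPT$ and $S$ is selected from $\theta$ independent RRR samples, then $\mathbb E[\sigma(S)]\ge(\rho-\varepsilon)\,OPT$, the expectation being over the samples and the partition. Moreover, with probability at least $1-\eta$ over the samples, the conditional expectation of $\sigma(S)$ over the partition is at least $(\rho-\varepsilon)\,OPT$. 2. (Whole algorithm.) The output $S$ of GreediRIS always has $|S|\le k$. With probability at least $1-\eta$ over the final samples, the conditional expectation of $\sigma(S)$ over the final partition is at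 least $(\rho-\varepsilon)\,OPT$. If $\eta\le\varepsilon$, then $\mathbb E[\sigma(S)]\ge(\rho-\varepsilon)\,OPT$, the expectation being over all the randomness of the algorithm. -/

import Mathlib

open scoped NNReal ENNReal

noncomputable section

namespace GreediRIS

/-! ## Finite probability -/

section Probability

/-- The law of independent coordinates `x i` with laws `p i`. -/
def piPMF {ι : Type*} [Fintype ι] {α : ι → Type*} [∀ i, Fintype (α i)]
    (p : ∀ i, PMF (α i)) : PMF (∀ i, α i) :=
  letI : DecidableEq ι := Classical.decEq ι
  PMF.ofFintype (fun x => ∏ i, p i (x i)) (by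
    classical
    have h := Finset.prod_univ_sum (fun i => (Finset.univ : Finset (α i))) (fun i a => p i a)
    have h1 : ∀ i, ∑ a, p i a = 1 := fun i => by
      rw [← tsum_fintype (L := .unconditional _)]; exact (p i).tsum_coe
    simp only [h1, Finset.prod_const_one, Fintype.piFinset_univ] at h
    convert h.symm)

/-- A coin that shows `true` with probability `p`. -/
def coin (p : ℝ≥0) (hp : p ≤ 1) : PMF Bool :=
  PMF.ofFintype (fun b => cond b (p : ℝ≥0∞) (1 - (p : ℝ≥0∞))) (by simp [hp])

/-- A list of `θ` independent samples with law `p`. -/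
def iidSamples {α : Type*} (p : PMF α) : ℕ → PMF (List α)
  | 0 => PMF.pure []
  | θ + 1 => p.bind fun r => (iidSamples p θ).map fun L => r :: L

/-- A maximizer of `f` on a nonempty finite set. -/
def bestOf {ι : Type*} (s : Finset ι) (hs : s.Nonempty) (f : ι → ℕ) : ι :=
  (Finset.exists_max_image s f hs).choose

end Probability

/-! ## Diffusion models, influence and random reverse reachable sets -/

/-- A diffusion process on the directed graph `G`. -/
inductive DiffusionModel {V : Type*} [Fintype V] (G : Digraph V) where
  /-- Independent cascade: an active `u` activates `v` along the edge `(u, v)` with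
  probability `p u v`. -/
  | independentCascade (p : V → V → ℝ≥0) (le_one : ∀ u v, p u v ≤ 1)
      (off_edge : ∀ u v, ¬ G.Adj u v → p u v = 0)
  /-- Linear threshold: edge weights `w u v`, of total incoming weight at most `1` at every
  vertex. -/
  | linearThreshold (w : V → V → ℝ≥0) (sum_le_one : ∀ v, ∑ u, w u v ≤ 1)
      (off_edge : ∀ u v, ¬ G.Adj u v → w u v = 0)

section Diffusion

variable {V : Type*} [Fintype V] [DecidableEq V] {G : Digraph V}

/-- The independent coins of the edges; `g u v` tells whether the single attempt of `u` to
activate `v` succeeds. -/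
def edgeCoins (p : V → V → ℝ≥0) (hp : ∀ u v, p u v ≤ 1) : PMF (V → V → Bool) :=
  piPMF fun u => piPMF fun v => coin (p u v) (hp u v)

/-- One step of independent cascade, given the outcomes of the edge coins. -/
def cascadeStep (g : V → V → Bool) (A : Finset V) : Finset V :=
  A ∪ Finset.univ.filter fun v => ∃ u ∈ A, g u v = true

open Classical in
/-- One step of linear threshold, given the thresholds `τ`. -/
def thresholdStep (w : V → V → ℝ≥0) (τ : V → ℝ) (A : Finset V) : Finset V :=
  A ∪ Finset.univ.filter fun v => τ v ≤ ∑ u ∈ A, (w u v : ℝ)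

/-- The expected number of active vertices at the end of the diffusion process started from the
seed set `S`. No activation can happen after `card V` steps. In the linear threshold model the
thresholds are independent and uniform on `[0, 1]`. -/
def influence : DiffusionModel G → Finset V → ℝ
  | .independentCascade p hp _, S =>
      ∑ g, (edgeCoins p hp g).toReal * (((cascadeStep g)^[Fintype.card V] S).card : ℝ)
  | .linearThreshold w _ _, S =>
      ∫ τ in Set.Icc (0 : V → ℝ) 1, (((thresholdStep w τ)^[Fintype.card V] S).card : ℝ)

/-- The largest influence of a seed set of at most `k` vertices. -/
def optInfluence (M : DiffusionModel G) (k : ℕ) : ℝ :=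
  (Finset.univ.filter fun S : Finset V => S.card ≤ k).sup' ⟨∅, by simp⟩ (influence M)

/-- The expected influence of a random seed set with law `p`. -/
def expectedInfluence (M : DiffusionModel G) (p : PMF (Finset V)) : ℝ :=
  ∑ S, (p S).toReal * influence M S

/-- A random in-neighbour: `u` with probability `w u`, and none with the remaining
probability. -/
def inNeighbor (w : V → ℝ≥0) (hw : ∑ u, w u ≤ 1) : PMF (Option V) :=
  PMF.ofFintype
    (fun o => o.elim (((1 - ∑ u, w u : ℝ≥0)) : ℝ≥0∞) fun u => ((w u : ℝ≥0) : ℝ≥0∞)) (by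
    rw [Fintype.sum_option]
    simp only [Option.elim]
    rw [← ENNReal.ofNNReal_finsetSum, ← ENNReal.coe_add, tsub_add_cancel_of_le hw,
      ENNReal.coe_one])

/-- The random subgraph of live edges: independent edges for independent cascade, at most one
edge into each vertex, chosen according to the weights, for linear threshold. -/
def liveEdges : DiffusionModel G → PMF (V → V → Bool)
  | .independentCascade p hp _ => edgeCoins p hp
  | .linearThreshold w hw _ =>
      (piPMF fun v => inNeighbor (fun u => w u v) (hw v)).map fun c u v => decide (c v = some u)

open Classical in
/-- The vertices from which `u` is reachable in the subgraph `g`. -/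
def reverseReachable (g : V → V → Bool) (u : V) : Finset V :=
  Finset.univ.filter fun v => Relation.ReflTransGen (fun a b => g a b = true) v u

/-- The law of a random reverse reachable set of a uniformly random vertex. -/
def rrSample [Nonempty V] (M : DiffusionModel G) : PMF (Finset V) :=
  (PMF.uniformOfFintype V).bind fun u => (liveEdges M).map fun g => reverseReachable g u

end Diffusion

/-! ## Seed selection: distributed greedy with streaming aggregation -/

section SeedSelection

variable {V : Type*} [Fintype V] [LinearOrder V]

/-- The indices of the samples that contain `v`. -/
def coveringSet (R : List (Finset V)) (v : V) : Finset (Fin R.length) :=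
  Finset.univ.filter fun i => v ∈ R.get i

/-- The number of samples covered by `S`. -/
def coverage (R : List (Finset V)) (S : Finset V) : ℕ :=
  (S.biUnion (coveringSet R)).card

/-- The vertices of `A` outside `S` of largest marginal coverage with respect to `S`. -/
def greedyCandidates (R : List (Finset V)) (A S : Finset V) : Finset V :=
  (A \ S).filter fun v => ∀ u ∈ A \ S, coverage R (insert u S) ≤ coverage R (insert v S)

/-- The first `j` seeds of greedy max cover on the vertex set `A`, in order of selection; among
vertices of equal marginal coverage the smallest one is selected. The list is shorter than `j`
only if `A` is exhausted. -/
def greedySeeds (R : List (Finset V)) (A : Finset V) : ℕ → List V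
  | 0 => []
  | j + 1 =>
      let L := greedySeeds R A j
      if h : (greedyCandidates R A L.toFinset).Nonempty then
        L ++ [(greedyCandidates R A L.toFinset).min' h]
      else L

/-- A bucket receives the vertex `v`. Its state is the pair of its seed set and of the set of
samples covered by it. -/
def bucketInsert (R : List (Finset V)) (k : ℕ) (t : ℝ)
    (s : Finset V × Finset (Fin R.length)) (v : V) : Finset V × Finset (Fin R.length) :=
  open Classical in
  if s.1.card < k ∧ t ≤ ((coveringSet R v \ s.2).card : ℝ) then
    (insert v s.1, s.2 ∪ coveringSet R v)
  else s

/-- The largest coverage of a single vertex of the stream: the lower bound `l` on the optimal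
coverage of `k` vertices of the stream, for which `u = k * l` is an upper bound. -/
def streamLower (R : List (Finset V)) (stream : List V) : ℕ :=
  stream.toFinset.sup fun v => (coveringSet R v).card

/-- The final state of the bucket `b`, whose guess of the optimal coverage is
`l * (1 + δ) ^ b`. -/
def bucket (R : List (Finset V)) (k : ℕ) (δ : ℝ) (stream : List V) (b : ℕ) :
    Finset V × Finset (Fin R.length) :=
  stream.foldl
    (bucketInsert R k ((streamLower R stream : ℝ) * (1 + δ) ^ b / (2 * k))) (∅, ∅)

/-- The number of buckets: `log_{1+δ} (u / l)` with `u / l = k`, rounded up, and at least one. -/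
def numBuckets (k : ℕ) (δ : ℝ) : ℕ := max 1 ⌈Real.logb (1 + δ) k⌉₊

/-- One-pass streaming max cover: the seed set of the bucket of largest coverage. -/
def streamingCover (R : List (Finset V)) (k : ℕ) (δ : ℝ) (stream : List V) : Finset V :=
  (bucket R k δ stream
    (bestOf (Finset.range (numBuckets k δ)) ⟨0, by simp [numBuckets]⟩
      fun b => (bucket R k δ stream b).2.card)).1

/-- The seed set computed by `m` machines from the samples `R` when machine `i` holds the
vertices `v` with `part v = i`. All local greedy seeds are sent to the receiver, where they
arrive in the order given by `arrival`; the better one of the streamed solution and the best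
local solution is returned. -/
def roundOutput (m k : ℕ) [NeZero m] (δ : ℝ)
    (arrival : List (Finset V) → (V → Fin m) → List V → List V)
    (R : List (Finset V)) (part : V → Fin m) : Finset V :=
  let loc : Fin m → List V := fun i =>
    greedySeeds R (Finset.univ.filter fun v => part v = i) k
  let Sg := streamingCover R k δ (arrival R part (List.ofFn loc).flatten)
  let Sl := (loc (bestOf Finset.univ Finset.univ_nonempty
    fun i => coverage R (loc i).toFinset)).toFinset
  if coverage R Sl ≤ coverage R Sg then Sg else Sl

/-- Seed selection: `roundOutput` for a uniformly random partition of the vertices. -/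
def selectSeeds (m k : ℕ) [NeZero m] (δ : ℝ)
    (arrival : List (Finset V) → (V → Fin m) → List V → List V)
    (R : List (Finset V)) : PMF (Finset V) :=
  (PMF.uniformOfFintype (V → Fin m)).map (roundOutput m k δ arrival R)

end SeedSelection

/-! ## The IMM sampling scheme -/

section IMM

/-- The constant `λ*` of IMM for failure probability `η`. -/
def lamStar (n k : ℕ) (ε η : ℝ) : ℝ :=
  2 * n * ((1 - 1 / Real.exp 1) * √(Real.log (2 / η)) +
    √((1 - 1 / Real.exp 1) * (Real.log (n.choose k) + Real.log (2 / η)))) ^ 2 / ε ^ 2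

/-- The constant `λ'` of the estimation phase of IMM, for the precision `ε'` and failure
probability `η`. -/
def lamPrime (n k : ℕ) (ε' η : ℝ) : ℝ :=
  (2 + 2 / 3 * ε') *
    (Real.log (n.choose k) + Real.log (1 / η) + Real.log (Real.logb 2 n)) * n / ε' ^ 2

variable {V : Type*} [Fintype V] [LinearOrder V] [Nonempty V] {G : Digraph V}

/-- At most `fuel` further martingale rounds, the next of which has index `i`, uses `θ` samples
and keeps the samples `R` of the previous rounds. The result is the lower bound `LB` on the
optimal influence. -/
def martingaleRounds (M : DiffusionModel G) (m k : ℕ) [NeZero m] (δ ε' : ℝ)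
    (arrival : List (Finset V) → (V → Fin m) → List V → List V) :
    (fuel i θ : ℕ) → (R : List (Finset V)) → PMF ℝ
  | 0, _, _, _ => PMF.pure 1
  | fuel + 1, i, θ, R =>
      (iidSamples (rrSample M) (θ - R.length)).bind fun new =>
        (selectSeeds m k δ arrival (R ++ new)).bind fun S =>
          let est : ℝ := Fintype.card V * coverage (R ++ new) S / (R ++ new).length
          open Classical in
          if (1 + ε') * (Fintype.card V / 2 ^ i) ≤ est then PMF.pure (est / (1 + ε'))
          else martingaleRounds M m k δ ε' arrival fuel (i + 1) (2 * θ) (R ++ new)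

/-- The estimation phase, with failure probability `η` and internal precision `√2 * ε`. -/
def lowerBound (M : DiffusionModel G) (m k : ℕ) [NeZero m] (δ ε η : ℝ)
    (arrival : List (Finset V) → (V → Fin m) → List V → List V) : PMF ℝ :=
  martingaleRounds M m k δ (√2 * ε) arrival (Nat.log 2 (Fintype.card V)) 1
    ⌈2 * lamPrime (Fintype.card V) k (√2 * ε) η / Fintype.card V⌉₊ []

/-- The samples on which the final seeds are selected: `⌈λ* / LB⌉` fresh ones. The failure
probability `η` is shared equally by the estimation phase and the final phase. -/
def finalSamples (M : DiffusionModel G) (m k : ℕ) [NeZero m] (δ ε η : ℝ)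
    (arrival : List (Finset V) → (V → Fin m) → List V → List V) : PMF (List (Finset V)) :=
  (lowerBound M m k δ ε (η / 2) arrival).bind fun LB =>
    iidSamples (rrSample M) ⌈lamStar (Fintype.card V) k ε (η / 2) / LB⌉₊

/-- The law of the output of the whole algorithm. -/
def greediRIS (M : DiffusionModel G) (m k : ℕ) [NeZero m] (δ ε η : ℝ)
    (arrival : List (Finset V) → (V → Fin m) → List V → List V) : PMF (Finset V) :=
  (finalSamples M m k δ ε η arrival).bind (selectSeeds m k δ arrival)

end IMM

/-- `α * β / (α + β)` with `α = 1 - 1 / e` and `β = 1 / 2 - δ`. -/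
def ratio (δ : ℝ) : ℝ :=
  ((1 - 1 / Real.exp 1) * (1 / 2 - δ)) / ((1 - 1 / Real.exp 1) + (1 / 2 - δ))

end GreediRIS

end

/-! Three facts carry the theorem. Write α = 1 - 1/e, β = 1/2 - δ, ρ = αβ/(α+β). (1) For fixed
samples, the expected coverage of the selected seeds is at least ρ C(T) for every T of at most k
vertices (`ratio_mul_le_sum_coverage`). The vertices of T selected on their own machine reach the
stream, where the buckets lose a factor β. The vertices that machine j would reject can be given to
it all at once without changing its greedy run, which loses a factor α. Moving one vertex to a
uniformly random machine preserves the uniform partition, so on average the two kinds account for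
all of T, and C(T) ≤ (1/α + 1/β) E C(S). (2) σ(S)/n is the probability that a random reverse
reachable set meets S (`influence_eq`). For linear threshold this rests on
`expect_card_activated_congr`: thresholds and random in-neighbours give the same one-vertex
activation probabilities. (3) The selected S depends on the samples, so C(S) is bounded above in
terms of σ(S) uniformly over all nonempty sets of at most k vertices, by exponential moments with
parameter 3ε. For the optimal set, which is fixed, the mean coverage (`le_expect_influence`) or a
lower tail (`prob_not_le_expectedInfluence`) suffices. Since ρ ≤ 0.28, the number of samples
dictated by `lamStar` leaves room: the mean version gives ρ - 0.84ε. Of the estimation phase only 0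
< LB ≤ OPT is needed, which holds up to probability η/2 (`prob_lowerBound_le`); the final samples
are fresh, so (3) applies for each such LB. The unused 0.16ε pays for the failures of the estimation
when the overall expectation is taken. -/

noncomputable section

set_option linter.unusedSectionVars false

namespace GreediRIS

/-! ## Expectations of nonnegative functions under a `PMF` -/

section Expect

variable {α β : Type*}

/-- The expectation of a nonnegative function. -/
def expect (p : PMF α) (f : α → ℝ≥0∞) : ℝ≥0∞ := ∑' a, p a * f a

lemma expect_pure (a : α) (f : α → ℝ≥0∞) : expect (PMF.pure a) f = f a := by
  classical
  unfold expect
  rw [tsum_eq_single a]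
  · simp
  · intro b hb; simp [PMF.pure_apply, hb]

lemma expect_bind (p : PMF α) (q : α → PMF β) (f : β → ℝ≥0∞) :
    expect (p.bind q) f = expect p fun a => expect (q a) f := by
  unfold expect
  simp_rw [PMF.bind_apply, ← ENNReal.tsum_mul_right, ← ENNReal.tsum_mul_left]
  rw [ENNReal.tsum_comm]
  simp_rw [mul_assoc]

lemma expect_map (p : PMF α) (g : α → β) (f : β → ℝ≥0∞) :
    expect (p.map g) f = expect p fun a => f (g a) := by
  rw [← PMF.bind_pure_comp, expect_bind]
  simp [expect_pure]

lemma expect_mono (p : PMF α) {f g : α → ℝ≥0∞} (h : ∀ a, f a ≤ g a) :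
    expect p f ≤ expect p g :=
  ENNReal.tsum_le_tsum fun a => mul_le_mul_right (h a) _

lemma expect_mono_support (p : PMF α) {f g : α → ℝ≥0∞} (h : ∀ a ∈ p.support, f a ≤ g a) :
    expect p f ≤ expect p g := by
  refine ENNReal.tsum_le_tsum fun a => ?_
  by_cases ha : a ∈ p.support
  · exact mul_le_mul_right (h a ha) _
  · rw [PMF.mem_support_iff, not_not] at ha; simp [ha]

lemma expect_add (p : PMF α) (f g : α → ℝ≥0∞) :
    (expect p fun a => f a + g a) = expect p f + expect p g := by
  unfold expect
  simp_rw [mul_add]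
  exact ENNReal.tsum_add

lemma expect_const_mul (p : PMF α) (c : ℝ≥0∞) (f : α → ℝ≥0∞) :
    (expect p fun a => c * f a) = c * expect p f := by
  unfold expect
  rw [← ENNReal.tsum_mul_left]
  simp_rw [mul_left_comm]

lemma expect_const (p : PMF α) (c : ℝ≥0∞) : (expect p fun _ => c) = c := by
  unfold expect
  rw [ENNReal.tsum_mul_right, p.tsum_coe, one_mul]

lemma expect_sum {ι : Type*} (p : PMF α) (s : Finset ι) (f : ι → α → ℝ≥0∞) :
    (expect p fun a => ∑ i ∈ s, f i a) = ∑ i ∈ s, expect p (f i) := by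
  classical
  induction s using Finset.induction_on with
  | empty => simpa using expect_const p 0
  | insert i s hi ih => simp_rw [Finset.sum_insert hi]; rw [expect_add, ih]

lemma expect_fintype [Fintype α] (p : PMF α) (f : α → ℝ≥0∞) :
    expect p f = ∑ a, p a * f a := tsum_fintype _

lemma expect_uniform [Fintype α] [Nonempty α] (f : α → ℝ≥0∞) :
    expect (PMF.uniformOfFintype α) f = (∑ a, f a) / Fintype.card α := by
  rw [expect_fintype]
  simp_rw [PMF.uniformOfFintype_apply]
  rw [← Finset.mul_sum, div_eq_mul_inv, mul_comm]

/-- The probability of an event. -/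
def prob (p : PMF α) (E : α → Prop) : ℝ≥0∞ :=
  open Classical in expect p fun a => if E a then 1 else 0

lemma toOuterMeasure_eq_prob (p : PMF α) (s : Set α) :
    p.toOuterMeasure s = prob p (· ∈ s) := by
  classical
  rw [PMF.toOuterMeasure_apply]
  unfold prob expect
  refine tsum_congr fun a => ?_
  by_cases h : a ∈ s <;> simp [h]

lemma prob_mono (p : PMF α) {E F : α → Prop} (h : ∀ a, E a → F a) : prob p E ≤ prob p F := by
  classical
  refine expect_mono p fun a => ?_
  by_cases hE : E a
  · simp [hE, h a hE]
  · simp [hE]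

lemma prob_mono_support (p : PMF α) {E F : α → Prop} (h : ∀ a ∈ p.support, E a → F a) :
    prob p E ≤ prob p F := by
  classical
  refine expect_mono_support p fun a ha => ?_
  by_cases hE : E a
  · simp [hE, h a ha hE]
  · simp [hE]

lemma prob_bind (p : PMF α) (q : α → PMF β) (E : β → Prop) :
    prob (p.bind q) E = expect p fun a => prob (q a) E := expect_bind _ _ _

lemma prob_le_one (p : PMF α) (E : α → Prop) : prob p E ≤ 1 := by
  classical
  refine (expect_mono p fun a => ?_).trans (expect_const p 1).le
  split_ifs <;> simp

lemma prob_add_prob_not (p : PMF α) (E : α → Prop) :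
    prob p E + prob p (fun a => ¬ E a) = 1 := by
  classical
  unfold prob
  rw [← expect_add]
  refine Eq.trans ?_ (expect_const p 1)
  congr 1
  funext a
  by_cases h : E a <;> simp [h]

lemma prob_or_le (p : PMF α) (E F : α → Prop) :
    prob p (fun a => E a ∨ F a) ≤ prob p E + prob p F := by
  classical
  unfold prob
  rw [← expect_add]
  refine expect_mono p fun a => ?_
  by_cases h : E a <;> by_cases h' : F a <;> simp [h, h']

lemma prob_exists_le {ι : Type*} (p : PMF α) (s : Finset ι) (E : ι → α → Prop) :
    prob p (fun a => ∃ i ∈ s, E i a) ≤ ∑ i ∈ s, prob p (E i) := by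
  classical
  unfold prob
  rw [← expect_sum]
  refine expect_mono p fun a => ?_
  split_ifs with h
  · obtain ⟨i, hi, hE⟩ := h
    refine le_trans ?_ (Finset.single_le_sum (f := fun i => if E i a then (1 : ℝ≥0∞) else 0)
      (fun _ _ => zero_le) hi)
    simp [hE]
  · exact zero_le

/-- Markov's inequality in exponential form. -/
lemma prob_le_expect_exp (p : PMF α) (f : α → ℝ) (c : ℝ) :
    prob p (fun a => c ≤ f a) ≤
      ENNReal.ofReal (Real.exp (-c)) * expect p fun a => ENNReal.ofReal (Real.exp (f a)) := by
  classical
  unfold prob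
  rw [← expect_const_mul]
  refine expect_mono p fun a => ?_
  split_ifs with h
  · rw [← ENNReal.ofReal_mul (Real.exp_pos _).le, ← Real.exp_add, ENNReal.one_le_ofReal]
    exact Real.one_le_exp (by linarith)
  · exact zero_le

lemma one_sub_le_toReal_toOuterMeasure (p : PMF α) (s : Set α) {η : ℝ} (hη : 0 ≤ η)
    (h : prob p (fun a => a ∉ s) ≤ ENNReal.ofReal η) :
    1 - η ≤ (p.toOuterMeasure s).toReal := by
  rw [toOuterMeasure_eq_prob]
  have h1 := prob_add_prob_not p (· ∈ s)
  have hf : prob p (· ∈ s) ≠ ∞ := ne_top_of_le_ne_top ENNReal.one_ne_top (prob_le_one p _)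
  have hf' : prob p (fun a => a ∉ s) ≠ ∞ :=
    ne_top_of_le_ne_top ENNReal.one_ne_top (prob_le_one p _)
  have h2 := congrArg ENNReal.toReal h1
  rw [ENNReal.toReal_add hf hf', ENNReal.toReal_one] at h2
  have h3 := ENNReal.toReal_mono ENNReal.ofReal_ne_top h
  rw [ENNReal.toReal_ofReal hη] at h3
  linarith

lemma toReal_expect_ofReal [Fintype α] (p : PMF α) (f : α → ℝ) (hf : ∀ a, 0 ≤ f a) :
    (expect p fun a => ENNReal.ofReal (f a)).toReal = ∑ a, (p a).toReal * f a := by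
  rw [expect_fintype, ENNReal.toReal_sum fun a _ =>
    ENNReal.mul_ne_top (p.apply_ne_top a) ENNReal.ofReal_ne_top]
  refine Finset.sum_congr rfl fun a _ => ?_
  rw [ENNReal.toReal_mul, ENNReal.toReal_ofReal (hf a)]

/-- Swapping j with the coordinate x o is an involution on pairs (x, j). This resampling identity
serves both the random partition and the exchange of activation laws. -/
lemma sum_update_eq {ι κ M : Type*} [Fintype ι] [DecidableEq ι] [Fintype κ] [AddCommMonoid M]
    (o : ι) (h : (ι → κ) → M) :
    ∑ x : ι → κ, ∑ j, h (Function.update x o j) = Fintype.card κ • ∑ x, h x := by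
  have h1 : Fintype.card κ • ∑ x, h x = ∑ x : ι → κ, ∑ _j : κ, h x := by
    simp [Finset.smul_sum]
  rw [h1, ← Finset.sum_product', ← Finset.sum_product']
  refine Finset.sum_nbij' (fun x => (Function.update x.1 o x.2, x.1 o))
    (fun x => (Function.update x.1 o x.2, x.1 o)) ?_ ?_ ?_ ?_ ?_ <;> simp

lemma piPMF_apply {ι : Type*} [Fintype ι] {κ : ι → Type*} [∀ i, Fintype (κ i)]
    (p : ∀ i, PMF (κ i)) (x : ∀ i, κ i) : piPMF p x = ∏ i, p i (x i) := rfl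

lemma piPMF_map {ι : Type*} [Fintype ι] {κ κ' : ι → Type*} [∀ i, Fintype (κ i)]
    [∀ i, Fintype (κ' i)] (p : ∀ i, PMF (κ i)) (h : ∀ i, κ i → κ' i) :
    (piPMF p).map (fun x i => h i (x i)) = piPMF fun i => (p i).map (h i) := by
  classical
  ext y
  simp only [PMF.map_apply, piPMF_apply, tsum_fintype]
  rw [Finset.prod_univ_sum, Fintype.piFinset_univ]
  refine Finset.sum_congr rfl fun x _ => ?_
  rw [Finset.prod_ite_zero]
  simp [funext_iff]

/-- Independent laws may be replaced at one coordinate `o` as long as the expectation conditional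
on the other coordinates is not changed. -/
lemma expect_piPMF_congr {ι κ : Type*} [Fintype ι] [DecidableEq ι] [Fintype κ] (p q : ι → PMF κ)
    (o : ι) (hpq : ∀ i ≠ o, p i = q i) (f : (ι → κ) → ℝ≥0∞)
    (h : ∀ x, (expect (p o) fun a => f (Function.update x o a)) =
      expect (q o) fun a => f (Function.update x o a)) :
    expect (piPMF p) f = expect (piPMF q) f := by
  -- The factor `card κ` allows summing over full points x although the summand ignores x o; it is
  -- cancelled at the end.
  have key : ∀ p : ι → PMF κ, (Fintype.card κ : ℝ≥0∞) * expect (piPMF p) f =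
      ∑ x : ι → κ, (∏ i ∈ Finset.univ.erase o, p i (x i)) *
        expect (p o) fun a => f (Function.update x o a) := by
    intro p
    rw [← nsmul_eq_mul, expect_fintype, ← sum_update_eq o]
    refine Finset.sum_congr rfl fun x _ => ?_
    rw [expect_fintype, Finset.mul_sum]
    refine Finset.sum_congr rfl fun a _ => ?_
    rw [piPMF_apply, ← Finset.mul_prod_erase _ _ (Finset.mem_univ o), Function.update_self,
      Finset.prod_congr rfl fun i hi => by
        rw [Function.update_of_ne (Finset.ne_of_mem_erase hi)]]
    ring
  have hcard : (Fintype.card κ : ℝ≥0∞) ≠ 0 := by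
    have : Nonempty κ := (p o).support_nonempty.to_type
    exact_mod_cast Fintype.card_ne_zero
  rw [← ENNReal.mul_right_inj hcard (ENNReal.natCast_ne_top _), key, key]
  refine Finset.sum_congr rfl fun x _ => ?_
  rw [h x, Finset.prod_congr rfl fun i hi => by rw [hpq i (Finset.ne_of_mem_erase hi)]]

lemma expect_ite (p : PMF α) (E : α → Prop) [DecidablePred E] (a b : ℝ≥0∞) :
    (expect p fun x => if E x then a else b) = a * prob p E + b * prob p fun x => ¬ E x := by
  classical
  unfold prob
  rw [← expect_const_mul, ← expect_const_mul, ← expect_add]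
  congr 1
  funext x
  by_cases h : E x <;> simp [h]

lemma prob_not (p : PMF α) (E : α → Prop) : prob p (fun x => ¬ E x) = 1 - prob p E := by
  rw [← prob_add_prob_not p E, ENNReal.add_sub_cancel_left
    (ne_top_of_le_ne_top ENNReal.one_ne_top (prob_le_one p _))]

lemma expect_iidSamples_succ (p : PMF α) (θ : ℕ) (f : List α → ℝ≥0∞) :
    expect (iidSamples p (θ + 1)) f =
      expect p fun r => expect (iidSamples p θ) fun L => f (r :: L) := by
  simp only [iidSamples, expect_bind, expect_map]

lemma expect_iidSamples_add (p : PMF α) (a b : ℕ) (f : List α → ℝ≥0∞) :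
    expect (iidSamples p (a + b)) f =
      expect (iidSamples p a) fun L => expect (iidSamples p b) fun L' => f (L ++ L') := by
  induction a generalizing f with
  | zero => simp [iidSamples, expect_pure]
  | succ a ih =>
    rw [Nat.add_right_comm, expect_iidSamples_succ, expect_iidSamples_succ]
    simp_rw [ih, List.cons_append]

lemma length_of_mem_support_iidSamples (p : PMF α) (θ : ℕ) :
    ∀ L ∈ (iidSamples p θ).support, L.length = θ := by
  induction θ with
  | zero => simp [iidSamples]
  | succ θ ih =>
    intro L hL
    simp only [iidSamples, PMF.mem_support_bind_iff, PMF.support_map, Set.mem_image] at hL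
    obtain ⟨r, -, L', hL', rfl⟩ := hL
    simp [ih L' hL']

end Expect

/-! ## Coverage, greedy and streaming max cover -/

section Cover

variable {V : Type*} [LinearOrder V]

lemma coverage_empty (R : List (Finset V)) : coverage R ∅ = 0 := by simp [coverage]

lemma coverage_mono (R : List (Finset V)) {S T : Finset V} (h : S ⊆ T) :
    coverage R S ≤ coverage R T :=
  Finset.card_le_card (Finset.biUnion_subset_biUnion_of_subset_left _ h)

lemma coverage_insert (R : List (Finset V)) (v : V) (S : Finset V) :
    coverage R (insert v S) =
      coverage R S + (coveringSet R v \ S.biUnion (coveringSet R)).card := by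
  unfold coverage
  rw [Finset.biUnion_insert, Finset.union_comm, ← Finset.union_sdiff_self_eq_union,
    Finset.card_union_of_disjoint Finset.disjoint_sdiff]

lemma coverage_eq_sum (R : List (Finset V)) (S : Finset V) :
    coverage R S = ∑ i : Fin R.length, if ∃ v ∈ S, i ∈ coveringSet R v then 1 else 0 := by
  rw [← Finset.card_filter]
  unfold coverage
  congr 1
  ext i
  simp

/-- Submodularity: the coverage of `T` exceeds that of `S` by at most the sum of the marginal
coverages of the vertices of `T`. -/
lemma coverage_le_add_sum (R : List (Finset V)) (S T : Finset V) :
    coverage R T ≤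
      coverage R S + ∑ v ∈ T, (coveringSet R v \ S.biUnion (coveringSet R)).card := by
  refine le_trans ?_ (Nat.add_le_add_left (Finset.card_biUnion_le (s := T)) _)
  refine le_trans (Finset.card_le_card ?_) (Finset.card_union_le _ _)
  intro i hi
  rw [Finset.mem_biUnion] at hi
  obtain ⟨v, hv, hi⟩ := hi
  by_cases h : i ∈ S.biUnion (coveringSet R)
  · exact Finset.mem_union_left _ h
  · exact Finset.mem_union_right _
      (Finset.mem_biUnion.2 ⟨v, hv, Finset.mem_sdiff.2 ⟨hi, h⟩⟩)

variable [Fintype V]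

/-- The next greedy seed. -/
def greedyPick (R : List (Finset V)) (A S : Finset V) : Option V :=
  if h : (greedyCandidates R A S).Nonempty then some ((greedyCandidates R A S).min' h) else none

lemma greedySeeds_succ (R : List (Finset V)) (A : Finset V) (j : ℕ) :
    greedySeeds R A (j + 1) =
      greedySeeds R A j ++ (greedyPick R A (greedySeeds R A j).toFinset).toList := by
  simp only [greedySeeds, greedyPick]
  split_ifs <;> simp

lemma greedyPick_eq_some_iff (R : List (Finset V)) (A S : Finset V) (x : V) :
    greedyPick R A S = some x ↔ x ∈ A \ S ∧ ∀ u ∈ A \ S,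
      coverage R (insert u S) ≤ coverage R (insert x S) ∧
        (coverage R (insert u S) = coverage R (insert x S) → x ≤ u) := by
  unfold greedyPick
  split_ifs with h
  · rw [Option.some.injEq]
    constructor
    · rintro rfl
      have hm := Finset.min'_mem _ h
      generalize hx : (greedyCandidates R A S).min' h = x at hm
      have hm' := Finset.mem_filter.1 hm
      refine ⟨hm'.1, fun u hu => ⟨hm'.2 u hu, fun he => ?_⟩⟩
      rw [← hx]
      refine Finset.min'_le _ _ (Finset.mem_filter.2 ⟨hu, fun w hw => ?_⟩)
      rw [he]; exact hm'.2 w hw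
    · rintro ⟨hx, hu⟩
      have hxm : x ∈ greedyCandidates R A S :=
        Finset.mem_filter.2 ⟨hx, fun u hu' => (hu u hu').1⟩
      refine le_antisymm (Finset.min'_le _ _ hxm) (Finset.le_min' _ _ _ fun y hy => ?_)
      have hy' := Finset.mem_filter.1 hy
      exact (hu y hy'.1).2 (le_antisymm (hu y hy'.1).1 (hy'.2 x hx))
  · simp only [false_iff, not_and]
    intro hx hu
    exact h ⟨x, Finset.mem_filter.2 ⟨hx, fun u hu' => (hu u hu').1⟩⟩

lemma greedyPick_eq_none_iff (R : List (Finset V)) (A S : Finset V) :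
    greedyPick R A S = none ↔ A ⊆ S := by
  unfold greedyPick
  split_ifs with h
  · simp only [false_iff]
    obtain ⟨x, hx⟩ := h
    have := (Finset.mem_sdiff.1 (Finset.mem_filter.1 hx).1)
    exact fun hs => this.2 (hs this.1)
  · simp only [true_iff]
    rw [← Finset.sdiff_eq_empty_iff_subset]
    by_contra hne
    obtain ⟨x, hx, hmax⟩ := Finset.exists_max_image (A \ S)
      (fun v => coverage R (insert v S)) (Finset.nonempty_iff_ne_empty.2 hne)
    exact h ⟨x, Finset.mem_filter.2 ⟨hx, hmax⟩⟩

/-- The next greedy seed does not change when other vertices are removed. -/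
lemma greedyPick_of_subset (R : List (Finset V)) {A B S : Finset V} (h : A ⊆ B) {x : V}
    (hB : greedyPick R B S = some x) (hx : x ∈ A) : greedyPick R A S = some x := by
  rw [greedyPick_eq_some_iff] at hB ⊢
  refine ⟨Finset.mem_sdiff.2 ⟨hx, (Finset.mem_sdiff.1 hB.1).2⟩, fun u hu => hB.2 u ?_⟩
  exact Finset.sdiff_subset_sdiff h le_rfl hu

lemma greedySeeds_subset_of_le (R : List (Finset V)) (A : Finset V) {i j : ℕ} (h : i ≤ j) :
    greedySeeds R A i ⊆ greedySeeds R A j := by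
  induction j, h using Nat.le_induction with
  | base => exact List.Subset.refl _
  | succ j _ ih =>
    rw [greedySeeds_succ]
    exact List.Subset.trans ih (List.subset_append_left _ _)

lemma length_greedySeeds_le (R : List (Finset V)) (A : Finset V) (j : ℕ) :
    (greedySeeds R A j).length ≤ j := by
  induction j with
  | zero => simp [greedySeeds]
  | succ j ih =>
    rw [greedySeeds_succ, List.length_append]
    have : (greedyPick R A (greedySeeds R A j).toFinset).toList.length ≤ 1 := by
      cases greedyPick R A (greedySeeds R A j).toFinset <;> simp
    omega

/-- Consistency of greedy: vertices none of which is selected when it alone is added to `A` do not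
change the outcome when they are added together. -/
lemma greedySeeds_union_eq (R : List (Finset V)) (k : ℕ) (A O : Finset V)
    (hO : ∀ o ∈ O, o ∉ greedySeeds R (insert o A) k) :
    greedySeeds R (A ∪ O) k = greedySeeds R A k := by
  -- The runs on `insert o A` must be carried along, because the hypothesis speaks only of them.
  suffices H : ∀ j ≤ k, greedySeeds R (A ∪ O) j = greedySeeds R A j ∧
      ∀ o ∈ O, greedySeeds R (insert o A) j = greedySeeds R A j from (H k le_rfl).1
  intro j
  induction j with
  | zero => intro _; simp [greedySeeds]
  | succ j ih =>
    intro hj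
    obtain ⟨h1, h2⟩ := ih (by omega)
    have hsub : ∀ o ∈ O, insert o A ⊆ A ∪ O := fun o ho =>
      Finset.insert_subset (Finset.mem_union_right _ ho) Finset.subset_union_left
    have key : greedyPick R (A ∪ O) (greedySeeds R A j).toFinset =
          greedyPick R A (greedySeeds R A j).toFinset ∧
        ∀ o ∈ O, greedyPick R (insert o A) (greedySeeds R A j).toFinset =
          greedyPick R A (greedySeeds R A j).toFinset := by
      cases hp : greedyPick R (A ∪ O) (greedySeeds R A j).toFinset with
      | none =>
        rw [greedyPick_eq_none_iff] at hp
        have hA := (greedyPick_eq_none_iff R A _).2 (Finset.subset_union_left.trans hp)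
        rw [hA]
        exact ⟨rfl, fun o ho => (greedyPick_eq_none_iff R _ _).2 ((hsub o ho).trans hp)⟩
      | some y =>
        -- A pick y in O from the large set would also be the pick from `insert y A`, whose run has
        -- agreed so far.
        have hyO : y ∉ O := by
          intro hy
          have hpy := greedyPick_of_subset R (hsub y hy) hp (Finset.mem_insert_self _ _)
          refine hO y hy (greedySeeds_subset_of_le R _ hj ?_)
          rw [greedySeeds_succ, h2 y hy, hpy]
          simp
        have hyA : y ∈ A := by
          have := (Finset.mem_sdiff.1 ((greedyPick_eq_some_iff R _ _ y).1 hp).1).1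
          exact (Finset.mem_union.1 this).resolve_right hyO
        have hA := greedyPick_of_subset R Finset.subset_union_left hp hyA
        rw [hA]
        exact ⟨rfl, fun o ho =>
          greedyPick_of_subset R (hsub o ho) hp (Finset.mem_insert_of_mem hyA)⟩
    refine ⟨?_, fun o ho => ?_⟩
    · rw [greedySeeds_succ, greedySeeds_succ, h1, key.1]
    · rw [greedySeeds_succ, greedySeeds_succ, h2 o ho, key.2 o ho]

/-- By submodularity the coverage still missing from T is at most the sum of at most k marginal
gains, none larger than that of the greedy pick. If nothing is left to pick, T is already contained
in the seeds. -/
lemma greedySeeds_step (R : List (Finset V)) (A T : Finset V) (hT : T ⊆ A) {k : ℕ}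
    (hk : T.card ≤ k) (j : ℕ) :
    (coverage R T : ℝ) - coverage R (greedySeeds R A j).toFinset ≤
      k * ((coverage R (greedySeeds R A (j + 1)).toFinset : ℝ) -
        coverage R (greedySeeds R A j).toFinset) := by
  rw [greedySeeds_succ]
  set S := (greedySeeds R A j).toFinset with hS
  cases hp : greedyPick R A S with
  | none =>
    have : coverage R T ≤ coverage R S :=
      coverage_mono R (hT.trans ((greedyPick_eq_none_iff R A S).1 hp))
    have : (coverage R T : ℝ) ≤ coverage R S := by exact_mod_cast this
    simp only [Option.toList_none, List.append_nil, ← hS, sub_self, mul_zero]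
    linarith
  | some x =>
    have hx := (greedyPick_eq_some_iff R A S x).1 hp
    have hset : (greedySeeds R A j ++ (some x).toList).toFinset = insert x S := by
      ext v; simp [hS]
    rw [hset, coverage_insert]
    have hle : ∀ v ∈ T, (coveringSet R v \ S.biUnion (coveringSet R)).card ≤
        (coveringSet R x \ S.biUnion (coveringSet R)).card := by
      intro v hv
      by_cases hvS : v ∈ S
      · rw [Finset.sdiff_eq_empty_iff_subset.2 (Finset.subset_biUnion_of_mem _ hvS)]
        simp
      · have := (hx.2 v (Finset.mem_sdiff.2 ⟨hT hv, hvS⟩)).1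
        rw [coverage_insert, coverage_insert] at this
        omega
    have h1 := coverage_le_add_sum R S T
    have h2 := Finset.sum_le_card_nsmul T _ _ hle
    have h3 : coverage R T ≤
        coverage R S + k * (coveringSet R x \ S.biUnion (coveringSet R)).card := by
      refine h1.trans (Nat.add_le_add_left (h2.trans ?_) _)
      rw [smul_eq_mul]
      exact Nat.mul_le_mul_right _ hk
    have h4 : (coverage R T : ℝ) ≤
        coverage R S + k * (coveringSet R x \ S.biUnion (coveringSet R)).card := by
      exact_mod_cast h3
    push_cast
    linarith

/-- Greedy is a `1 - 1/e` approximation for max cover. -/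
lemma greedySeeds_approx (R : List (Finset V)) (A T : Finset V) (hT : T ⊆ A) {k : ℕ}
    (hk : 1 ≤ k) (hTk : T.card ≤ k) :
    (1 - 1 / Real.exp 1) * coverage R T ≤ coverage R (greedySeeds R A k).toFinset := by
  have hk0 : (0 : ℝ) < k := by exact_mod_cast hk
  have hk1 : (1 : ℝ) ≤ k := by exact_mod_cast hk
  have hq : 0 ≤ 1 - 1 / (k : ℝ) := by
    rw [sub_nonneg, div_le_one hk0]; exact hk1
  have H : ∀ j, (coverage R T : ℝ) - coverage R (greedySeeds R A j).toFinset ≤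
      (1 - 1 / (k : ℝ)) ^ j * coverage R T := by
    intro j
    induction j with
    | zero => simp [greedySeeds, coverage_empty]
    | succ j ih =>
      have hstep := greedySeeds_step R A T hT hTk j
      rw [pow_succ, mul_right_comm]
      refine le_trans ?_ (mul_le_mul_of_nonneg_right ih hq)
      set a := (coverage R T : ℝ)
      set b := (coverage R (greedySeeds R A j).toFinset : ℝ)
      set c := (coverage R (greedySeeds R A (j + 1)).toFinset : ℝ)
      have h1 : (a - b) / k ≤ c - b := by
        rw [div_le_iff₀ hk0]; linarith
      have h2 : (a - b) * (1 - 1 / (k : ℝ)) = (a - b) - (a - b) / k := by ring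
      rw [h2]; linarith
  have hexp : (1 - 1 / (k : ℝ)) ^ k ≤ 1 / Real.exp 1 := by
    have h1 : 1 - 1 / (k : ℝ) ≤ Real.exp (-(1 / (k : ℝ))) := by
      have := Real.add_one_le_exp (-(1 / (k : ℝ))); linarith
    refine (pow_le_pow_left₀ hq h1 k).trans (le_of_eq ?_)
    rw [← Real.exp_nat_mul, one_div (Real.exp 1), ← Real.exp_neg]
    congr 1
    field_simp
  have h1 := H k
  have h2 := mul_le_mul_of_nonneg_right hexp (Nat.cast_nonneg (α := ℝ) (coverage R T))
  linarith

end Cover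

/-! ### Streaming max cover with threshold buckets. -/

section Streaming

variable {V : Type*} [LinearOrder V]

lemma le_bestOf {ι : Type*} (s : Finset ι) (hs : s.Nonempty) (f : ι → ℕ) {i : ι} (hi : i ∈ s) :
    f i ≤ f (bestOf s hs f) := (Finset.exists_max_image s f hs).choose_spec.2 i hi

/-- The state of a bucket of threshold `t` after the vertices of a list have arrived. -/
lemma foldl_bucketInsert (R : List (Finset V)) (k : ℕ) {t : ℝ} (ht : 0 ≤ t) (L : List V) :
    let s := L.foldl (bucketInsert R k t) (∅, ∅)
    s.2 = s.1.biUnion (coveringSet R) ∧ s.1.card ≤ k ∧ t * s.1.card ≤ s.2.card ∧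
      (s.1.card < k → ∀ v ∈ L, ((coveringSet R v \ s.2).card : ℝ) ≤ t) := by
  induction L using List.reverseRecOn with
  | nil => simp
  | append_singleton L v ih =>
    simp only [List.foldl_append, List.foldl_cons, List.foldl_nil]
    obtain ⟨h1, h2, h3, h4⟩ := ih
    generalize L.foldl (bucketInsert R k t) (∅, ∅) = s at h1 h2 h3 h4 ⊢
    unfold bucketInsert
    split_ifs with h
    · obtain ⟨hc, hg⟩ := h
      have hcard : (insert v s.1).card ≤ s.1.card + 1 := Finset.card_insert_le _ _
      have hcov : (s.2 ∪ coveringSet R v).card =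
          s.2.card + (coveringSet R v \ s.2).card := by
        rw [← Finset.union_sdiff_self_eq_union,
          Finset.card_union_of_disjoint Finset.disjoint_sdiff]
      refine ⟨?_, by simp only; omega, ?_, ?_⟩
      · simp only [Finset.biUnion_insert, ← h1, Finset.union_comm]
      · simp only [hcov]
        have hcard' : ((insert v s.1).card : ℝ) ≤ s.1.card + 1 := by exact_mod_cast hcard
        push_cast
        nlinarith [mul_le_mul_of_nonneg_left hcard' ht]
      -- Marginal gains only shrink as the bucket grows, and an accepted vertex has gain zero
      -- afterwards.
      · intro _ u hu
        simp only
        rcases List.mem_append.1 hu with hu | hu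
        · refine le_trans ?_ (h4 hc u hu)
          exact_mod_cast Finset.card_le_card
            (Finset.sdiff_subset_sdiff le_rfl Finset.subset_union_left)
        · rw [List.mem_singleton.1 hu, Finset.sdiff_eq_empty_iff_subset.2
            Finset.subset_union_right]
          simpa using ht
    · refine ⟨h1, h2, h3, fun hc u hu => ?_⟩
      rcases List.mem_append.1 hu with hu | hu
      · exact h4 hc u hu
      · rw [List.mem_singleton.1 hu]
        by_contra hlt
        exact h ⟨hc, (not_le.1 hlt).le⟩

lemma bucket_coverage (R : List (Finset V)) (k : ℕ) {δ : ℝ} (hδ : 0 < δ) (stream : List V)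
    (b : ℕ) : (bucket R k δ stream b).2.card = coverage R (bucket R k δ stream b).1 := by
  have h := (foldl_bucketInsert R k
    (t := (streamLower R stream : ℝ) * (1 + δ) ^ b / (2 * k)) (by positivity) stream).1
  unfold coverage
  exact congrArg Finset.card h

/-- A bucket whose guess `v` is at most `coverage R T` covers at least `v / 2`. -/
lemma le_bucket (R : List (Finset V)) {k : ℕ} (hk : 1 ≤ k) {δ : ℝ} (hδ : 0 < δ)
    (stream : List V) (b : ℕ) (T : Finset V) (hT : T ⊆ stream.toFinset) (hTk : T.card ≤ k)
    (hb : (streamLower R stream : ℝ) * (1 + δ) ^ b ≤ coverage R T) :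
    (streamLower R stream : ℝ) * (1 + δ) ^ b / 2 ≤ (bucket R k δ stream b).2.card := by
  have hk0 : (0 : ℝ) < k := by exact_mod_cast hk
  set v := (streamLower R stream : ℝ) * (1 + δ) ^ b with hv
  have hv0 : 0 ≤ v := by positivity
  have ht : 0 ≤ v / (2 * k) := by positivity
  obtain ⟨h1, h2, h3, h4⟩ := foldl_bucketInsert R k ht stream
  change (bucket R k δ stream b).2 = _ at h1
  change (bucket R k δ stream b).1.card ≤ k at h2
  change v / (2 * k) * (bucket R k δ stream b).1.card ≤ (bucket R k δ stream b).2.card at h3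
  change (bucket R k δ stream b).1.card < k → ∀ u ∈ stream,
    ((coveringSet R u \ (bucket R k δ stream b).2).card : ℝ) ≤ v / (2 * k) at h4
  change (bucket R k δ stream b).2 = (bucket R k δ stream b).1.biUnion (coveringSet R) at h1
  generalize bucket R k δ stream b = s at h1 h2 h3 h4 ⊢
  -- If the bucket is not full, every vertex of T gains at most v/(2k) over it, so T exceeds it by
  -- at most v/2. If it is full, k vertices each brought at least v/(2k).
  rcases h2.lt_or_eq with hc | hc
  · have h5 := coverage_le_add_sum R s.1 T
    rw [← h1] at h5
    have h6 : (coverage R T : ℝ) ≤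
        coverage R s.1 + ∑ u ∈ T, ((coveringSet R u \ s.2).card : ℝ) := by exact_mod_cast h5
    have h7 : ∑ u ∈ T, ((coveringSet R u \ s.2).card : ℝ) ≤ k * (v / (2 * k)) := by
      refine (Finset.sum_le_card_nsmul T _ (v / (2 * k)) fun u hu =>
        h4 hc u (List.mem_toFinset.1 (hT hu))).trans ?_
      rw [nsmul_eq_mul]
      exact mul_le_mul_of_nonneg_right (by exact_mod_cast hTk) ht
    have h8 : (k : ℝ) * (v / (2 * k)) = v / 2 := by field_simp
    have h9 : coverage R s.1 = s.2.card := by rw [coverage, h1]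
    rw [h9] at h6
    linarith
  · rw [hc] at h3
    have h8 : v / (2 * k) * (k : ℝ) = v / 2 := by field_simp
    linarith

/-- The right inequality is not strict so that the number of buckets suffices: with B the number of
buckets, the natural exponent can be out of range only if x = k = q ^ B, and then B - 1 serves. -/
lemma exists_geometric_guess {q x : ℝ} (hq : 1 < q) (hx : 1 ≤ x) {k : ℕ} (hxk : x ≤ k) :
    ∃ b < max 1 ⌈Real.logb q k⌉₊, q ^ b ≤ x ∧ x ≤ q ^ (b + 1) := by
  obtain ⟨b, hb1, hb2⟩ := exists_nat_pow_near hx hq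
  have hx0 : 0 < x := by linarith
  by_cases hb : b < max 1 ⌈Real.logb q k⌉₊
  · exact ⟨b, hb, hb1, hb2.le⟩
  · push Not at hb
    set B := max 1 ⌈Real.logb q k⌉₊ with hB
    have hB1 : 1 ≤ B := le_max_left _ _
    have hk0 : (0 : ℝ) < k := by linarith
    have hkB : (k : ℝ) ≤ q ^ B := by
      rw [← Real.rpow_natCast, ← Real.logb_le_iff_le_rpow hq hk0]
      exact (Nat.le_ceil _).trans (by exact_mod_cast le_max_right _ _)
    refine ⟨B - 1, by omega, ?_, ?_⟩
    · exact (pow_le_pow_right₀ hq.le (by omega)).trans hb1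
    · rw [Nat.sub_add_cancel hB1]; exact hxk.trans hkB

/-- Streaming max cover is a `1/2 - δ` approximation. -/
lemma streamingCover_approx (R : List (Finset V)) {k : ℕ} (hk : 1 ≤ k) {δ : ℝ} (hδ : 0 < δ)
    (stream : List V) (T : Finset V) (hT : T ⊆ stream.toFinset) (hTk : T.card ≤ k) :
    (1 / 2 - δ) * coverage R T ≤ coverage R (streamingCover R k δ stream) := by
  by_cases hT0 : coverage R T = 0
  · simp [hT0]
  have hbest : ∀ b < numBuckets k δ, (bucket R k δ stream b).2.card ≤
      coverage R (streamingCover R k δ stream) := by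
    intro b hb
    unfold streamingCover
    rw [← bucket_coverage R k hδ]
    exact le_bestOf (Finset.range (numBuckets k δ)) _
      (fun b => (bucket R k δ stream b).2.card) (Finset.mem_range.2 hb)
  -- The guess is matched to the best set U of the stream instead of T: l ≤ C(U) ≤ k l holds for U,
  -- while C(T) may be below l.
  obtain ⟨U, hU, hUmax⟩ := Finset.exists_max_image
    (stream.toFinset.powerset.filter fun U => U.card ≤ k) (coverage R) ⟨∅, by simp⟩
  simp only [Finset.mem_filter, Finset.mem_powerset] at hU hUmax
  have hTU : coverage R T ≤ coverage R U := hUmax T ⟨hT, hTk⟩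
  have hlU : streamLower R stream ≤ coverage R U := by
    refine Finset.sup_le fun v hv => ?_
    have := hUmax {v} ⟨by simpa using hv, by simpa using hk⟩
    simpa [coverage] using this
  have hUl : coverage R U ≤ k * streamLower R stream := by
    have h1 := Finset.card_biUnion_le (s := U) (t := coveringSet R)
    refine h1.trans ((Finset.sum_le_card_nsmul U _ (streamLower R stream) fun v hv =>
      Finset.le_sup (f := fun v => (coveringSet R v).card) (hU.1 hv)).trans ?_)
    rw [smul_eq_mul]
    exact Nat.mul_le_mul_right _ hU.2
  have hl0 : (0 : ℝ) < streamLower R stream := by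
    have : 0 < streamLower R stream := by
      rcases Nat.eq_zero_or_pos (streamLower R stream) with h | h
      · rw [h] at hUl; omega
      · exact h
    exact_mod_cast this
  have hlU' : (streamLower R stream : ℝ) ≤ coverage R U := by exact_mod_cast hlU
  have hUl' : (coverage R U : ℝ) ≤ k * streamLower R stream := by exact_mod_cast hUl
  have hTU' : (coverage R T : ℝ) ≤ coverage R U := by exact_mod_cast hTU
  obtain ⟨b, hb, hb1, hb2⟩ := exists_geometric_guess (q := 1 + δ)
    (x := coverage R U / streamLower R stream) (k := k) (by linarith)
    (by rw [le_div_iff₀ hl0]; linarith) (by rw [div_le_iff₀ hl0]; exact hUl')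
  rw [le_div_iff₀ hl0] at hb1
  rw [div_le_iff₀ hl0, pow_succ] at hb2
  have h1 := le_bucket R hk hδ stream b U hU.1 hU.2 (by linarith)
  have h2 : ((bucket R k δ stream b).2.card : ℝ) ≤
      coverage R (streamingCover R k δ stream) := by exact_mod_cast hbest b hb
  set v := (streamLower R stream : ℝ) * (1 + δ) ^ b with hv
  have hv0 : 0 ≤ v := by positivity
  have h3 : (coverage R U : ℝ) ≤ v * (1 + δ) := by rw [hv]; linarith
  have hCT : (0 : ℝ) ≤ coverage R T := Nat.cast_nonneg _
  -- The geometric rounding is absorbed by (1/2 - δ)(1 + δ) ≤ 1/2.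
  have h4 : (1 / 2 - δ) * coverage R T ≤ v / 2 := by
    rcases le_or_gt (1 / 2 - δ) 0 with h | h
    · exact (mul_nonpos_of_nonpos_of_nonneg h hCT).trans (by positivity)
    · calc (1 / 2 - δ) * (coverage R T : ℝ) ≤ (1 / 2 - δ) * (v * (1 + δ)) :=
            mul_le_mul_of_nonneg_left (hTU'.trans h3) h.le
        _ ≤ v / 2 := by nlinarith [mul_nonneg hv0 hδ.le, mul_nonneg (mul_nonneg hv0 hδ.le) hδ.le]
  linarith

lemma card_streamingCover_le (R : List (Finset V)) (k : ℕ) {δ : ℝ} (hδ : 0 < δ)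
    (stream : List V) : (streamingCover R k δ stream).card ≤ k := by
  unfold streamingCover
  exact (foldl_bucketInsert R k (by positivity) stream).2.1

end Streaming

/-! ### Averaging over the random partition. -/

section RandomizedPartition

variable {V : Type*} [Fintype V] [LinearOrder V]

/-- The seeds selected by machine `i`. -/
def localSeeds {m : ℕ} (k : ℕ) (R : List (Finset V)) (part : V → Fin m) (i : Fin m) : List V :=
  greedySeeds R (Finset.univ.filter fun v => part v = i) k

variable {m k : ℕ}

/-- The vertices of `T` that are selected on their own machine. -/
def selectedPart (k : ℕ) (R : List (Finset V)) (part : V → Fin m) (T : Finset V) : Finset V :=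
  T.filter fun o => o ∈ localSeeds k R part (part o)

/-- The vertices of `T` that machine `j` would not select if it held them in addition. -/
def rejectedPart (k : ℕ) (R : List (Finset V)) (part : V → Fin m) (T : Finset V) (j : Fin m) :
    Finset V :=
  T.filter fun o => o ∉ localSeeds k R (Function.update part o j) j

lemma filter_update_eq_insert (o : V) (j : Fin m) :
    (Finset.univ.filter fun v => Function.update part o j v = j) =
      insert o (Finset.univ.filter fun v => part v = j) := by
  ext v
  by_cases h : v = o
  · subst h; simp
  · simp [h]

/-- Coverage is a sum over samples, so for each sample covered by T a single covering vertex o can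
be followed. Resampling the machine of o shows that o is rejected by its own machine as often as by
a uniformly random machine j to which it is moved; being selected and being rejected are
complementary. -/
lemma le_sum_coverage (R : List (Finset V)) (T : Finset V) :
    m * (Fintype.card (V → Fin m) * coverage R T) ≤
      m * ∑ part : V → Fin m, coverage R (selectedPart k R part T) +
        ∑ part : V → Fin m, ∑ j, coverage R (rejectedPart k R part T j) := by
  simp_rw [coverage_eq_sum]
  rw [Finset.sum_comm]
  simp_rw [Finset.sum_comm (s := (Finset.univ : Finset (Fin m)))]
  rw [Finset.sum_comm (s := (Finset.univ : Finset (V → Fin m))), Finset.mul_sum, Finset.mul_sum,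
    Finset.mul_sum, ← Finset.sum_add_distrib]
  refine Finset.sum_le_sum fun i _ => ?_
  split_ifs with hi
  · obtain ⟨o, hoT, hoi⟩ := hi
    have h1 : ∀ part : V → Fin m, (if o ∈ localSeeds k R part (part o) then 1 else 0) ≤
        if ∃ v ∈ selectedPart k R part T, i ∈ coveringSet R v then 1 else 0 := by
      intro part
      split_ifs with ha hb
      · exact le_rfl
      · exact (hb ⟨o, Finset.mem_filter.2 ⟨hoT, ha⟩, hoi⟩).elim
      · exact zero_le_one
      · exact le_rfl
    have h2 : ∀ (part : V → Fin m) (j : Fin m),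
        (if o ∈ localSeeds k R (Function.update part o j) (Function.update part o j o)
          then 0 else 1) ≤
        if ∃ v ∈ rejectedPart k R part T j, i ∈ coveringSet R v then 1 else 0 := by
      intro part j
      rw [Function.update_self]
      split_ifs with ha hb hb
      · exact zero_le_one
      · exact le_rfl
      · exact le_rfl
      · exact (hb ⟨o, Finset.mem_filter.2 ⟨hoT, ha⟩, hoi⟩).elim
    -- Summing the rejections over j after the update is m times summing them over the own machine,
    -- which turns the two sums into m times the number of partitions.
    have h3 := sum_update_eq o fun part : V → Fin m =>
      if o ∈ localSeeds k R part (part o) then 0 else 1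
    refine le_trans (le_of_eq ?_) (add_le_add (Nat.mul_le_mul_left m
      (Finset.sum_le_sum fun part _ => h1 part))
      (Finset.sum_le_sum fun part _ => Finset.sum_le_sum fun j _ => h2 part j))
    rw [h3, Fintype.card_fin, smul_eq_mul, ← mul_add, ← Finset.sum_add_distrib, mul_one]
    congr 1
    rw [Fintype.card, Finset.card_eq_sum_ones]
    refine Finset.sum_congr rfl fun part _ => ?_
    split_ifs <;> rfl
  · simp

variable [NeZero m] {δ : ℝ}
  (arrival : List (Finset V) → (V → Fin m) → List V → List V)
  (R : List (Finset V)) (part : V → Fin m)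

lemma card_roundOutput_le (hδ : 0 < δ) : (roundOutput m k δ arrival R part).card ≤ k := by
  unfold roundOutput
  dsimp only
  split_ifs
  · exact card_streamingCover_le R k hδ _
  · exact (List.toFinset_card_le _).trans (length_greedySeeds_le _ _ _)

lemma coverage_localSeeds_le (i : Fin m) :
    coverage R (localSeeds k R part i).toFinset ≤
      coverage R (roundOutput m k δ arrival R part) := by
  have h := le_bestOf Finset.univ Finset.univ_nonempty
    (fun i => coverage R (localSeeds k R part i).toFinset) (Finset.mem_univ i)
  unfold roundOutput
  dsimp only [localSeeds] at h ⊢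
  split_ifs with h'
  · exact h.trans h'
  · exact h

lemma coverage_streamingCover_le :
    coverage R (streamingCover R k δ
      (arrival R part (List.ofFn (localSeeds k R part)).flatten)) ≤
      coverage R (roundOutput m k δ arrival R part) := by
  unfold roundOutput
  dsimp only [localSeeds]
  split_ifs with h'
  · exact le_rfl
  · exact (not_le.1 h').le

/-- These vertices are local seeds, hence in the stream in whatever order it arrives, and may serve
as comparison set for the streaming bound. -/
lemma coverage_selectedPart_le (hk : 1 ≤ k) (hδ : 0 < δ)
    (harrival : ∀ R part L, (arrival R part L).Perm L) (T : Finset V) (hT : T.card ≤ k) :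
    (1 / 2 - δ) * coverage R (selectedPart k R part T) ≤
      coverage R (roundOutput m k δ arrival R part) := by
  refine (streamingCover_approx R hk hδ
    (arrival R part (List.ofFn (localSeeds k R part)).flatten) _ ?_
    ((Finset.card_filter_le _ _).trans hT)).trans
    (by exact_mod_cast coverage_streamingCover_le arrival R part)
  intro o ho
  rw [List.mem_toFinset, (harrival R part _).mem_iff, List.mem_flatten]
  exact ⟨_, (List.mem_ofFn' _ _).2 ⟨part o, rfl⟩, (Finset.mem_filter.1 ho).2⟩

/-- By consistency, machine j would output the same seeds if it held all these vertices too, so the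
greedy bound on the enlarged vertex set applies to its actual output. -/
lemma coverage_rejectedPart_le (hk : 1 ≤ k) (T : Finset V) (hT : T.card ≤ k) (j : Fin m) :
    (1 - 1 / Real.exp 1) * coverage R (rejectedPart k R part T j) ≤
      coverage R (roundOutput m k δ arrival R part) := by
  refine le_trans ?_ (Nat.cast_le.2 (coverage_localSeeds_le arrival R part j))
  have h := greedySeeds_union_eq R k (Finset.univ.filter fun v => part v = j)
    (rejectedPart k R part T j) (fun o ho => by
      have := (Finset.mem_filter.1 ho).2
      rwa [localSeeds, filter_update_eq_insert] at this)
  rw [localSeeds, ← h]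
  exact greedySeeds_approx R _ _ Finset.subset_union_right hk
    ((Finset.card_filter_le _ _).trans hT)

/-- The approximation guarantee of distributed greedy max cover over a random partition. -/
lemma ratio_mul_le_sum_coverage (hk : 1 ≤ k) (hδ : 0 < δ) (hδ' : δ < 1 / 2)
    (harrival : ∀ R part L, (arrival R part L).Perm L) (T : Finset V) (hT : T.card ≤ k) :
    Fintype.card (V → Fin m) * (ratio δ * coverage R T) ≤
      ∑ part : V → Fin m, (coverage R (roundOutput m k δ arrival R part) : ℝ) := by
  have hα : 0 < 1 - 1 / Real.exp 1 := by
    rw [sub_pos, div_lt_one (Real.exp_pos 1)]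
    exact Real.one_lt_exp_iff.2 one_pos
  have hβ : 0 < 1 / 2 - δ := by linarith
  unfold ratio
  set α := 1 - 1 / Real.exp 1
  set β := 1 / 2 - δ
  have hm : (0 : ℝ) < m := by exact_mod_cast Nat.pos_of_ne_zero (NeZero.ne m)
  have h1 : (m : ℝ) * (Fintype.card (V → Fin m) * coverage R T) ≤
      m * ∑ part : V → Fin m, (coverage R (selectedPart k R part T) : ℝ) +
        ∑ part : V → Fin m, ∑ j, (coverage R (rejectedPart k R part T j) : ℝ) := by
    exact_mod_cast le_sum_coverage (k := k) R T
  set X := ∑ part : V → Fin m, (coverage R (roundOutput m k δ arrival R part) : ℝ)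
  have h2 : β * ∑ part : V → Fin m, (coverage R (selectedPart k R part T) : ℝ) ≤ X := by
    rw [Finset.mul_sum]
    exact Finset.sum_le_sum fun part _ =>
      coverage_selectedPart_le arrival R part hk hδ harrival T hT
  have h3 : α * ∑ part : V → Fin m, ∑ j, (coverage R (rejectedPart k R part T j) : ℝ) ≤
      m * X := by
    rw [Finset.mul_sum, Finset.mul_sum]
    refine Finset.sum_le_sum fun part _ => ?_
    rw [Finset.mul_sum]
    refine (Finset.sum_le_card_nsmul _ _ _ fun j _ =>
      coverage_rejectedPart_le (δ := δ) arrival R part hk T hT j).trans ?_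
    simp
  set P := (Fintype.card (V → Fin m) : ℝ)
  set c := (coverage R T : ℝ)
  set D := ∑ part : V → Fin m, (coverage R (selectedPart k R part T) : ℝ)
  set E := ∑ part : V → Fin m, ∑ j, (coverage R (rejectedPart k R part T j) : ℝ)
  have h4 : m * (α * β * (P * c)) ≤ m * ((α + β) * X) := by
    -- The weights αβ, αm and β make the selected and rejected sums cancel.
    have e1 := mul_le_mul_of_nonneg_left h1 (mul_pos hα hβ).le
    have e2 := mul_le_mul_of_nonneg_left h2 (mul_pos hα hm).le
    have e3 := mul_le_mul_of_nonneg_left h3 hβ.le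
    nlinarith
  have h5 := le_of_mul_le_mul_left h4 hm
  have h6 : P * (α * β / (α + β) * c) = α * β * (P * c) / (α + β) := by ring
  rw [h6, div_le_iff₀ (by positivity)]
  linarith

end RandomizedPartition

/-! ## Influence as the hitting probability of random reverse reachable sets -/

section Activation

variable {V : Type*} [Fintype V] [DecidableEq V]

/-- One step of the process in which `v` becomes active when the set `A` of active vertices
satisfies `f v A`. -/
def activationStep (f : V → Finset V → Bool) (A : Finset V) : Finset V :=
  A ∪ Finset.univ.filter fun v => f v A = true

/-- The final active set of the process started from `S`. -/
def activated (f : V → Finset V → Bool) (S : Finset V) : Finset V :=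
  (activationStep f)^[Fintype.card V] S

lemma subset_activated (f : V → Finset V → Bool) (S : Finset V) : S ⊆ activated f S := by
  unfold activated
  induction Fintype.card V with
  | zero => simp
  | succ j ih =>
    rw [Function.iterate_succ_apply']
    exact ih.trans Finset.subset_union_left

/-- Each step before stabilization adds a vertex, so after `card V` steps the set is stable or
everything. -/
lemma activationStep_activated (f : V → Finset V → Bool) (S : Finset V) :
    activationStep f (activated f S) = activated f S := by
  have H : ∀ j, activationStep f ((activationStep f)^[j] S) = (activationStep f)^[j] S ∨
      j ≤ ((activationStep f)^[j] S).card := by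
    intro j
    induction j with
    | zero => simp
    | succ j ih =>
      rw [Function.iterate_succ_apply']
      by_cases h : activationStep f ((activationStep f)^[j] S) = (activationStep f)^[j] S
      · left; rw [h, h]
      · right
        have hlt : (activationStep f)^[j] S ⊂ activationStep f ((activationStep f)^[j] S) :=
          lt_of_le_of_ne Finset.subset_union_left (Ne.symm h)
        have := Finset.card_lt_card hlt
        have := ih.resolve_left h
        omega
  rcases H (Fintype.card V) with h | h
  · exact h
  · have : activated f S = Finset.univ :=
      Finset.eq_univ_of_card _ (le_antisymm (Finset.card_le_univ _) h)
    rw [this]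
    exact Finset.univ_subset_iff.1 Finset.subset_union_left

lemma mem_activated_of_apply {f : V → Finset V → Bool} {S : Finset V} {v : V}
    (h : f v (activated f S) = true) : v ∈ activated f S := by
  rw [← activationStep_activated]
  exact Finset.mem_union_right _ (by simpa using h)

/-- With `subset_activated` and `mem_activated_of_apply`, this makes the final set the least closed
set containing S, so that later arguments need not follow the time steps. -/
lemma activated_subset {f : V → Finset V → Bool} (hf : ∀ v, Monotone (f v)) {S B : Finset V}
    (hS : S ⊆ B) (hB : ∀ v, f v B = true → v ∈ B) : activated f S ⊆ B := by
  unfold activated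
  induction Fintype.card V with
  | zero => simpa using hS
  | succ j ih =>
    rw [Function.iterate_succ_apply']
    refine Finset.union_subset ih fun v hv => hB v ?_
    exact Bool.le_iff_imp.1 (hf v ih) (Finset.mem_filter.1 hv).2

lemma activated_mono {f f' : V → Finset V → Bool} (hf : ∀ v, Monotone (f v))
    (h : ∀ v A, f v A = true → f' v A = true) (S : Finset V) :
    activated f S ⊆ activated f' S :=
  activated_subset hf (subset_activated f' S) fun v hv => mem_activated_of_apply (h v _ hv)

/-- The final active set depends on the activation function of a vertex `o` only through its
value at the set of vertices activated without `o`. -/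
lemma activated_eq_ite {f : V → Finset V → Bool} (hf : ∀ v, Monotone (f v)) (S : Finset V)
    (o : V) : activated f S =
      if f o (activated (Function.update f o fun _ => false) S) = true then
        activated (Function.update f o fun _ => true) S
      else activated (Function.update f o fun _ => false) S := by
  have hc : ∀ c : Bool, ∀ v, Monotone (Function.update f o (fun _ => c) v) := by
    intro c v
    by_cases h : v = o
    · subst h; rw [Function.update_self]; exact monotone_const
    · rw [Function.update_of_ne h]; exact hf v
  have hD : activated (Function.update f o fun _ => false) S ⊆ activated f S := by
    refine activated_mono (hc _) (fun v A h => ?_) S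
    by_cases hv : v = o
    · subst hv; simp at h
    · rwa [Function.update_of_ne hv] at h
  split_ifs with h
  · refine Finset.Subset.antisymm (activated_mono hf (fun v A h => ?_) S)
      (activated_subset (hc _) (subset_activated _ _) fun v hv => ?_)
    · by_cases hv : v = o
      · subst hv; simp
      · rwa [Function.update_of_ne hv]
    · by_cases hvo : v = o
      · subst hvo
        exact mem_activated_of_apply (Bool.le_iff_imp.1 (hf v hD) h)
      · rw [Function.update_of_ne hvo] at hv
        exact mem_activated_of_apply hv
  · refine Finset.Subset.antisymm (activated_subset hf (subset_activated _ _) fun v hv => ?_) hD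
    by_cases hvo : v = o
    · subst hvo; exact (h hv).elim
    · refine mem_activated_of_apply ?_
      rwa [Function.update_of_ne hvo]

instance : Finite (Finset V →o Bool) := DFunLike.finite _

noncomputable instance : Fintype (Finset V →o Bool) := Fintype.ofFinite _

/-- The expected number of activated vertices under independent random monotone activation
functions depends only on the probability, for each vertex and each set, that the set activates the
vertex. -/
lemma expect_card_activated_congr (p q : V → PMF (Finset V →o Bool))
    (h : ∀ v A, prob (p v) (fun x => x A = true) = prob (q v) fun x => x A = true)
    (S : Finset V) :
    (expect (piPMF p) fun f => ((activated (fun v => f v) S).card : ℝ≥0∞)) =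
      expect (piPMF q) fun f => ((activated (fun v => f v) S).card : ℝ≥0∞) := by
  -- The laws are exchanged one vertex at a time, s being the vertices already exchanged.
  suffices H : ∀ s : Finset V,
      (expect (piPMF p) fun f => ((activated (fun v => f v) S).card : ℝ≥0∞)) =
        expect (piPMF (s.piecewise q p)) fun f => ((activated (fun v => f v) S).card : ℝ≥0∞) by
    simpa using H Finset.univ
  intro s
  induction s using Finset.induction_on with
  | empty => simp
  | insert o s ho ih =>
    rw [ih]
    refine expect_piPMF_congr _ _ o (fun i hi => ?_) _ fun x => ?_
    · simp [Finset.piecewise, hi]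
    -- With the other functions fixed, the function a of o is queried at one set that does not
    -- depend on a, so only the probability of that answer enters.
    · have hx : ∀ a : Finset V →o Bool,
          ((activated (fun v => (Function.update x o a) v) S).card : ℝ≥0∞) =
          if a (activated (Function.update (fun v => (x v : Finset V → Bool)) o
              fun _ => false) S) = true then
            ((activated (Function.update (fun v => (x v : Finset V → Bool)) o
              fun _ => true) S).card : ℝ≥0∞)
          else ((activated (Function.update (fun v => (x v : Finset V → Bool)) o
              fun _ => false) S).card : ℝ≥0∞) := by
        intro a
        have hu : (fun v => ((Function.update x o a) v : Finset V → Bool)) =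
            Function.update (fun v => (x v : Finset V → Bool)) o a := by
          funext v
          by_cases hv : v = o
          · subst hv; simp
          · simp [Function.update_of_ne hv]
        rw [hu, activated_eq_ite (fun v => by rw [← hu]; exact (Function.update x o a v).monotone)
          S o]
        simp only [Function.update_idem, Function.update_self]
        split_ifs <;> rfl
      simp_rw [hx]
      rw [expect_ite, expect_ite, prob_not, prob_not,
        Finset.piecewise_eq_of_notMem _ _ _ ho,
        Finset.piecewise_eq_of_mem _ _ _ (Finset.mem_insert_self o s), h o]

end Activation

/-! ### Live edges, thresholds and reverse reachability. -/

section Influence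

variable {V : Type*} [Fintype V] [DecidableEq V] {G : Digraph V}

/-- The activation functions of a subgraph of live edges. -/
def edgeActivation (g : V → V → Bool) : V → Finset V →o Bool := fun v =>
  ⟨fun A => decide (∃ u ∈ A, g u v = true), fun A B h => by
    rw [Bool.le_iff_imp]
    simp only [decide_eq_true_eq]
    rintro ⟨u, hu, hg⟩
    exact ⟨u, h hu, hg⟩⟩

lemma edgeActivation_iff {g : V → V → Bool} {v : V} {A : Finset V} :
    edgeActivation g v A = true ↔ ∃ u ∈ A, g u v = true := decide_eq_true_iff

lemma mem_activated_edgeActivation (g : V → V → Bool) (S : Finset V) (v : V) :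
    v ∈ activated (fun v => edgeActivation g v) S ↔
      ∃ u ∈ S, Relation.ReflTransGen (fun a b => g a b = true) u v := by
  classical
  constructor
  · intro hv
    have h := activated_subset (f := fun v => edgeActivation g v) (S := S)
      (B := Finset.univ.filter fun v =>
        ∃ u ∈ S, Relation.ReflTransGen (fun a b => g a b = true) u v)
      (fun v => (edgeActivation g v).monotone)
      (fun u hu => Finset.mem_filter.2 ⟨Finset.mem_univ _, u, hu, .refl⟩)
      (fun v hv => by
        obtain ⟨w, hw, hwv⟩ := edgeActivation_iff.1 hv
        obtain ⟨u, hu, huw⟩ := (Finset.mem_filter.1 hw).2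
        exact Finset.mem_filter.2 ⟨Finset.mem_univ _, u, hu, huw.tail hwv⟩)
    exact (Finset.mem_filter.1 (h hv)).2
  · rintro ⟨u, hu, huv⟩
    induction huv with
    | refl => exact subset_activated _ _ hu
    | @tail b c _ hbc ih =>
      exact mem_activated_of_apply (edgeActivation_iff.2 ⟨b, ih, hbc⟩)

lemma iterate_cascadeStep (g : V → V → Bool) (S : Finset V) :
    (cascadeStep g)^[Fintype.card V] S = activated (fun v => edgeActivation g v) S := by
  unfold activated
  congr 1
  funext A
  ext v
  simp [cascadeStep, activationStep, edgeActivation_iff]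

/-- The activation function of a vertex of threshold `t` with incoming weights `w`. -/
def thresholdActivation (w : V → ℝ≥0) (t : ℝ) : Finset V →o Bool :=
  ⟨fun A => decide (t ≤ ∑ u ∈ A, (w u : ℝ)), fun A B h => by
    rw [Bool.le_iff_imp]
    simp only [decide_eq_true_eq]
    exact fun ht => ht.trans
      (Finset.sum_le_sum_of_subset_of_nonneg h fun _ _ _ => NNReal.coe_nonneg _)⟩

lemma thresholdActivation_iff {w : V → ℝ≥0} {t : ℝ} {A : Finset V} :
    thresholdActivation w t A = true ↔ t ≤ ∑ u ∈ A, (w u : ℝ) := decide_eq_true_iff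

lemma iterate_thresholdStep (w : V → V → ℝ≥0) (τ : V → ℝ) (S : Finset V) :
    (thresholdStep w τ)^[Fintype.card V] S =
      activated (fun v => thresholdActivation (fun u => w u v) (τ v)) S := by
  unfold activated
  congr 1
  funext A
  ext v
  simp [thresholdStep, activationStep, thresholdActivation_iff]

/-- The activation function of a vertex whose only live in-neighbour is `o`. -/
def neighborActivation (o : Option V) : Finset V →o Bool :=
  ⟨fun A => decide (∃ u ∈ A, o = some u), fun A B h => by
    rw [Bool.le_iff_imp]
    simp only [decide_eq_true_eq]
    rintro ⟨u, hu, hg⟩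
    exact ⟨u, h hu, hg⟩⟩

lemma prob_neighborActivation (w : V → ℝ≥0) (hw : ∑ u, w u ≤ 1) (A : Finset V) :
    prob ((inNeighbor w hw).map neighborActivation) (fun x => x A = true) =
      ∑ u ∈ A, (w u : ℝ≥0∞) := by
  classical
  unfold prob
  rw [expect_map, expect_fintype, Fintype.sum_option]
  simp [neighborActivation, inNeighbor, PMF.ofFintype_apply]

open MeasureTheory

instance : MeasurableSpace (Finset V →o Bool) := ⊤

instance : MeasurableSingletonClass (Finset V →o Bool) := ⟨fun _ => trivial⟩

lemma measurable_thresholdActivation (w : V → ℝ≥0) : Measurable (thresholdActivation w) := by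
  refine measurable_to_countable' fun x => ?_
  have : thresholdActivation w ⁻¹' {x} =
      ⋂ A : Finset V, {t : ℝ | decide (t ≤ ∑ u ∈ A, (w u : ℝ)) = x A} := by
    ext t
    simp only [Set.mem_preimage, Set.mem_singleton_iff, Set.mem_iInter, Set.mem_ofPred_eq]
    exact ⟨fun h A => by rw [← h]; rfl, fun h => OrderHom.ext _ _ (funext h)⟩
  rw [this]
  refine MeasurableSet.iInter fun A => ?_
  by_cases h : x A = true
  · simp only [h, decide_eq_true_eq]
    exact measurableSet_Iic
  · simp only [Bool.not_eq_true] at h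
    simp only [h, decide_eq_false_iff_not, not_le]
    exact measurableSet_Ioi

instance : IsProbabilityMeasure (volume.restrict (Set.Icc (0 : ℝ) 1)) :=
  ⟨by simp⟩

/-- The law of the activation function of a vertex with a random threshold. -/
def thresholdLaw (w : V → ℝ≥0) : Measure (Finset V →o Bool) :=
  (volume.restrict (Set.Icc (0 : ℝ) 1)).map (thresholdActivation w)

instance (w : V → ℝ≥0) : IsProbabilityMeasure (thresholdLaw w) :=
  Measure.isProbabilityMeasure_map (measurable_thresholdActivation w).aemeasurable

/-- The total weight of A is at most 1, hence equals the probability that a uniform threshold lies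
below it. A random in-neighbour lies in A with the same probability, which is all that
`expect_card_activated_congr` asks for. -/
lemma prob_thresholdLaw (w : V → ℝ≥0) (hw : ∑ u, w u ≤ 1) (A : Finset V) :
    prob (thresholdLaw w).toPMF (fun x => x A = true) = ∑ u ∈ A, (w u : ℝ≥0∞) := by
  have h1 : prob (thresholdLaw w).toPMF (fun x => x A = true) =
      thresholdLaw w {x | x A = true} := by
    change prob _ (fun x => x ∈ {x : Finset V →o Bool | x A = true}) = _
    rw [← toOuterMeasure_eq_prob (thresholdLaw w).toPMF {x | x A = true},
      ← PMF.toMeasure_apply_eq_toOuterMeasure,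
      Measure.toPMF_toMeasure]
  have hA : ∑ u ∈ A, (w u : ℝ) ≤ 1 := by
    have : ∑ u ∈ A, w u ≤ 1 :=
      (Finset.sum_le_sum_of_subset (Finset.subset_univ A)).trans hw
    exact_mod_cast this
  have h2 : thresholdActivation w ⁻¹' {x | x A = true} ∩ Set.Icc 0 1 =
      Set.Icc 0 (∑ u ∈ A, (w u : ℝ)) := by
    ext t
    simp only [Set.mem_inter_iff, Set.mem_preimage, Set.mem_ofPred_eq, thresholdActivation_iff,
      Set.mem_Icc]
    constructor
    · rintro ⟨h, h0, -⟩; exact ⟨h0, h⟩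
    · rintro ⟨h0, h⟩; exact ⟨h, h0, h.trans hA⟩
  rw [h1, thresholdLaw, Measure.map_apply (measurable_thresholdActivation w) trivial,
    Measure.restrict_apply (measurable_thresholdActivation w trivial), h2, Real.volume_Icc,
    sub_zero, ENNReal.ofReal_sum_of_nonneg fun _ _ => NNReal.coe_nonneg _]
  simp

/-- Thresholds matter only through the activation functions, of which there are finitely many;
pushing the product measure forward turns the integral into a finite sum. -/
lemma integral_threshold_eq (w : V → V → ℝ≥0) (Φ : (V → Finset V →o Bool) → ℝ)
    (hΦ : ∀ f, 0 ≤ Φ f) :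
    ∫ τ in Set.Icc (0 : V → ℝ) 1, Φ (fun v => thresholdActivation (fun u => w u v) (τ v)) =
      (expect (piPMF fun v => (thresholdLaw fun u => w u v).toPMF)
        fun f => ENNReal.ofReal (Φ f)).toReal := by
  have h1 : (volume : Measure (V → ℝ)).restrict (Set.Icc 0 1) =
      Measure.pi fun _ : V => volume.restrict (Set.Icc (0 : ℝ) 1) := by
    rw [volume_pi, ← Measure.restrict_pi_pi, Set.pi_univ_Icc]
    rfl
  have h2 := Measure.pi_map_pi (μ := fun _ : V => volume.restrict (Set.Icc (0 : ℝ) 1))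
    (f := fun v => thresholdActivation fun u => w u v)
    (fun v => (measurable_thresholdActivation _).aemeasurable)
  have hm : Measurable fun (τ : V → ℝ) v => thresholdActivation (fun u => w u v) (τ v) :=
    measurable_pi_lambda _ fun v =>
      (measurable_thresholdActivation _).comp (measurable_pi_apply v)
  rw [h1, ← integral_map hm.aemeasurable
    (f := Φ) (Measurable.of_discrete.aestronglyMeasurable), h2, integral_fintype
    (Integrable.of_finite), toReal_expect_ofReal _ _ hΦ]
  refine Finset.sum_congr rfl fun f _ => ?_
  rw [smul_eq_mul, Measure.real, Measure.pi_singleton, piPMF_apply]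
  simp only [Measure.toPMF_apply]
  rfl

/-- Influence is the expected number of vertices reachable through live edges. -/
lemma influence_eq_expect_liveEdges (M : DiffusionModel G) (S : Finset V) :
    influence M S = (expect (liveEdges M) fun g =>
      ((activated (fun v => edgeActivation g v) S).card : ℝ≥0∞)).toReal := by
  cases M with
  | independentCascade p hp _ =>
    simp only [influence, liveEdges]
    have h := toReal_expect_ofReal (edgeCoins p hp) (fun g =>
      (((cascadeStep g)^[Fintype.card V] S).card : ℝ)) fun _ => Nat.cast_nonneg _
    rw [← h]
    simp only [ENNReal.ofReal_natCast, iterate_cascadeStep]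
  | linearThreshold w hw _ =>
    simp only [influence, liveEdges, iterate_thresholdStep]
    have h := integral_threshold_eq w (fun f => ((activated (fun v => f v) S).card : ℝ))
      fun _ => Nat.cast_nonneg _
    rw [h]
    simp only [ENNReal.ofReal_natCast]
    rw [expect_card_activated_congr _
      (fun v => (inNeighbor (fun u => w u v) (hw v)).map neighborActivation)
      (fun v A => by rw [prob_thresholdLaw _ (hw v), prob_neighborActivation]) S,
      ← piPMF_map, expect_map, expect_map]
    congr 3
    funext c
    congr 4
    funext v
    congr 1
    ext A
    rw [Bool.eq_iff_iff, edgeActivation_iff]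
    simp only [decide_eq_true_eq]
    exact decide_eq_true_iff

variable [Nonempty V]

/-- A random reverse reachable set hits `S` with probability `influence M S / card V`. -/
lemma card_mul_prob_rrSample (M : DiffusionModel G) (S : Finset V) :
    (Fintype.card V : ℝ≥0∞) * prob (rrSample M) (fun r => ∃ v ∈ S, v ∈ r) =
      expect (liveEdges M) fun g =>
        ((activated (fun v => edgeActivation g v) S).card : ℝ≥0∞) := by
  classical
  have hn : (Fintype.card V : ℝ≥0∞) ≠ 0 := by exact_mod_cast Fintype.card_ne_zero
  unfold prob rrSample
  rw [expect_bind, expect_uniform, ENNReal.mul_div_cancel hn (ENNReal.natCast_ne_top _)]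
  simp_rw [expect_map]
  rw [← expect_sum]
  congr 1
  funext g
  -- For a fixed subgraph, the roots whose reverse reachable set meets S are the vertices reached
  -- from S.
  have h : activated (fun v => edgeActivation g v) S =
      Finset.univ.filter fun u => ∃ v ∈ S, v ∈ reverseReachable g u := by
    ext u
    rw [mem_activated_edgeActivation]
    simp [reverseReachable]
  rw [h, Finset.card_filter]
  push_cast
  refine Finset.sum_congr rfl fun u _ => ?_
  congr

lemma influence_eq (M : DiffusionModel G) (S : Finset V) :
    influence M S =
      Fintype.card V * (prob (rrSample M) fun r => ∃ v ∈ S, v ∈ r).toReal := by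
  rw [influence_eq_expect_liveEdges, ← card_mul_prob_rrSample]
  simp

lemma influence_nonneg (M : DiffusionModel G) (S : Finset V) : 0 ≤ influence M S := by
  rw [influence_eq]; positivity

lemma one_le_influence (M : DiffusionModel G) {S : Finset V} (hS : S.Nonempty) :
    1 ≤ influence M S := by
  rw [influence_eq_expect_liveEdges, ← ENNReal.toReal_one]
  refine ENNReal.toReal_mono (ne_top_of_le_ne_top (ENNReal.natCast_ne_top (Fintype.card V)) ?_) ?_
  · refine (expect_mono _ fun g => ?_).trans (expect_const (liveEdges M) _).le
    exact_mod_cast Finset.card_le_univ _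
  · refine (expect_const (liveEdges M) 1).symm.le.trans (expect_mono _ fun g => ?_)
    exact_mod_cast Finset.card_pos.2 (hS.mono (subset_activated _ _))

lemma influence_le_optInfluence (M : DiffusionModel G) {k : ℕ} {S : Finset V} (hS : S.card ≤ k) :
    influence M S ≤ optInfluence M k :=
  Finset.le_sup' (influence M) (Finset.mem_filter.2 ⟨Finset.mem_univ _, hS⟩)

lemma exists_influence_eq_optInfluence (M : DiffusionModel G) (k : ℕ) :
    ∃ S : Finset V, S.card ≤ k ∧ influence M S = optInfluence M k := by
  obtain ⟨S, hS, h⟩ := Finset.exists_mem_eq_sup'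
    (s := Finset.univ.filter fun S : Finset V => S.card ≤ k) ⟨∅, by simp⟩ (influence M)
  exact ⟨S, (Finset.mem_filter.1 hS).2, h.symm⟩

lemma one_le_optInfluence (M : DiffusionModel G) {k : ℕ} (hk : 1 ≤ k) :
    1 ≤ optInfluence M k := by
  obtain ⟨v⟩ := ‹Nonempty V›
  have : Nonempty V := ⟨v⟩
  exact (one_le_influence M (Finset.singleton_nonempty v)).trans
    (influence_le_optInfluence M (by simpa using hk))

end Influence

/-! ## Concentration of the coverage and the estimation phase -/

section Counting

/-- After multiplication by 1 - s/3, the difference of the two sides vanishes to first order at 0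
and has second derivative (1 - e^x (1 - x))/3 ≥ 0. This is the Bernstein form behind the exponent
ε²/(2 + 2ε/3) of `lamPrime`. -/
lemma exp_le_of_lt_three {s : ℝ} (h0 : 0 ≤ s) (h3 : s < 3) :
    Real.exp s ≤ 1 + s + s ^ 2 / (2 * (1 - s / 3)) := by
  have hd : ∀ x : ℝ, HasDerivAt
      (fun x => x ^ 2 / 2 - (1 - x / 3) * (Real.exp x - 1 - x))
      (x - (1 - x / 3) * (Real.exp x - 1) + (Real.exp x - 1 - x) / 3) x := by
    intro x
    have h1 := ((hasDerivAt_id x).pow 2).div_const 2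
    have h2 := ((hasDerivAt_id x).div_const 3).const_sub 1
    have h3 := ((Real.hasDerivAt_exp x).sub_const 1).sub (hasDerivAt_id x)
    refine (h1.sub (h2.mul h3)).congr_deriv ?_
    simp
    ring
  have hd2 : ∀ x : ℝ, HasDerivAt
      (fun x => x - (1 - x / 3) * (Real.exp x - 1) + (Real.exp x - 1 - x) / 3)
      ((1 - Real.exp x * (1 - x)) / 3) x := by
    intro x
    have h2 := ((hasDerivAt_id x).div_const 3).const_sub 1
    have h3 := (Real.hasDerivAt_exp x).sub_const 1
    have h4 := (h3.sub (hasDerivAt_id x)).div_const 3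
    refine (((hasDerivAt_id x).sub (h2.mul h3)).add h4).congr_deriv ?_
    simp
    ring
  have hnn : ∀ x : ℝ, 0 ≤ (1 - Real.exp x * (1 - x)) / 3 := by
    intro x
    have h := Real.add_one_le_exp (-x)
    have h' := mul_le_mul_of_nonneg_left h (Real.exp_pos x).le
    rw [← Real.exp_add, add_neg_cancel, Real.exp_zero] at h'
    linarith
  have hm2 := monotone_of_hasDerivAt_nonneg hd2 hnn
  have hm1 := monotoneOn_of_deriv_nonneg (convex_Ici (0 : ℝ))
    (f := fun x => x ^ 2 / 2 - (1 - x / 3) * (Real.exp x - 1 - x))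
    (fun x _ => (hd x).continuousAt.continuousWithinAt)
    (fun x _ => (hd x).differentiableAt.differentiableWithinAt)
    (fun x hx => by
      rw [(hd x).deriv]
      have : 0 ≤ x := by rw [interior_Ici] at hx; exact le_of_lt hx
      simpa using hm2 this)
  have h := hm1 (Set.self_mem_Ici) (show s ∈ Set.Ici (0 : ℝ) from h0) h0
  simp at h
  have hpos : 0 < 1 - s / 3 := by linarith
  have : Real.exp s - 1 - s ≤ s ^ 2 / (2 * (1 - s / 3)) := by
    rw [le_div_iff₀ (by positivity)]
    linarith
  linarith

lemma choose_le_choose_of_two_mul_le {n k j : ℕ} (hjk : j ≤ k) (hkn : 2 * k ≤ n) :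
    n.choose j ≤ n.choose k := by
  induction k, hjk using Nat.le_induction with
  | base => exact le_rfl
  | succ k _ ih =>
    exact (ih (by omega)).trans (Nat.choose_le_succ_of_lt_half_left (by omega))

lemma sq_le_choose {n k : ℕ} (hk : 1 ≤ k) (hkn : 2 * k ≤ n) : k ^ 2 ≤ n.choose k := by
  rcases hk.eq_or_lt with rfl | hk
  · simp; omega
  · refine le_trans ?_ (choose_le_choose_of_two_mul_le (show 2 ≤ k from hk) hkn)
    rw [Nat.choose_two_right, Nat.le_div_iff_mul_le two_pos]
    calc k ^ 2 * 2 = 2 * k * k := by ring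
      _ ≤ n * (n - 1) := Nat.mul_le_mul hkn (by omega)

variable (V : Type*) [Fintype V]

/-- The nonempty sets of at most `k` vertices. -/
def smallSets (k : ℕ) : Finset (Finset V) :=
  open Classical in Finset.univ.filter fun S => S.Nonempty ∧ S.card ≤ k

lemma card_smallSets_le {k : ℕ} (hkn : 2 * k ≤ Fintype.card V) :
    (smallSets V k).card ≤ k * (Fintype.card V).choose k := by
  classical
  have h : smallSets V k ⊆
      (Finset.Icc 1 k).biUnion fun j => Finset.powersetCard j Finset.univ := by
    intro S hS
    obtain ⟨h1, h2⟩ := (Finset.mem_filter.1 hS).2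
    exact Finset.mem_biUnion.2 ⟨S.card, Finset.mem_Icc.2 ⟨Finset.card_pos.2 h1, h2⟩,
      Finset.mem_powersetCard.2 ⟨Finset.subset_univ _, rfl⟩⟩
  refine (Finset.card_le_card h).trans (Finset.card_biUnion_le.trans ?_)
  refine (Finset.sum_le_card_nsmul _ _ ((Fintype.card V).choose k) fun j hj => ?_).trans ?_
  · rw [Finset.card_powersetCard, Finset.card_univ]
    exact choose_le_choose_of_two_mul_le (Finset.mem_Icc.1 hj).2 hkn
  · simp

/-- The output may have fewer than k seeds, and its coverage is compared with its own influence, so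
it cannot be enlarged to size k. The extra factor k for the sizes is at most the square root of the
binomial coefficient, whence 3/2. -/
lemma card_smallSets_le_exp {k : ℕ} (hk : 1 ≤ k) (hkn : 2 * k ≤ Fintype.card V) :
    ((smallSets V k).card : ℝ) ≤
      Real.exp (3 / 2 * Real.log ((Fintype.card V).choose k)) := by
  have h1 : ((smallSets V k).card : ℝ) ≤ k * (Fintype.card V).choose k := by
    exact_mod_cast card_smallSets_le V hkn
  have h2 : (k : ℝ) ^ 2 ≤ (Fintype.card V).choose k := by exact_mod_cast sq_le_choose hk hkn
  have hk0 : (0 : ℝ) < k := by exact_mod_cast hk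
  have hc : (0 : ℝ) < (Fintype.card V).choose k := lt_of_lt_of_le (by positivity) h2
  refine h1.trans ?_
  rw [← Real.log_le_iff_le_exp (by positivity), Real.log_mul hk0.ne' hc.ne']
  have h3 := Real.log_le_log (by positivity) h2
  rw [Real.log_pow] at h3
  push_cast at h3
  linarith

end Counting

/-! ### Chernoff bounds for the coverage and correctness of the estimation phase. -/

section Concentration

variable {V : Type*} [Fintype V] [LinearOrder V] [Nonempty V] {G : Digraph V}

lemma coverage_nil (S : Finset V) : coverage [] S = 0 := by
  rw [coverage_eq_sum]; rfl

lemma coverage_cons (r : Finset V) (R : List (Finset V)) (S : Finset V)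
    [Decidable (∃ v ∈ S, v ∈ r)] :
    coverage (r :: R) S = (if ∃ v ∈ S, v ∈ r then 1 else 0) + coverage R S := by
  rw [coverage_eq_sum, coverage_eq_sum]
  simp only [coveringSet, Finset.mem_filter, Finset.mem_univ, true_and]
  refine (Fin.sum_univ_succ (n := R.length) _).trans ?_
  congr

lemma ofReal_influence_div (M : DiffusionModel G) (S : Finset V) :
    ENNReal.ofReal (influence M S / Fintype.card V) =
      prob (rrSample M) fun r => ∃ v ∈ S, v ∈ r := by
  have hn : (Fintype.card V : ℝ) ≠ 0 := by exact_mod_cast Fintype.card_ne_zero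
  rw [influence_eq, mul_div_cancel_left₀ _ hn,
    ENNReal.ofReal_toReal (ne_top_of_le_ne_top ENNReal.one_ne_top (prob_le_one _ _))]

lemma influence_div_le_one (M : DiffusionModel G) (S : Finset V) :
    influence M S / Fintype.card V ≤ 1 := by
  have h := ofReal_influence_div M S ▸ prob_le_one (rrSample M) fun r => ∃ v ∈ S, v ∈ r
  exact ENNReal.ofReal_le_one.1 h

/-- The mean coverage of a fixed set. -/
lemma expect_coverage (M : DiffusionModel G) (S : Finset V) (θ : ℕ) :
    (expect (iidSamples (rrSample M) θ) fun R => (coverage R S : ℝ≥0∞)) =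
      ENNReal.ofReal (θ * (influence M S / Fintype.card V)) := by
  classical
  induction θ with
  | zero => simp [iidSamples, expect_pure, coverage_nil]
  | succ θ ih =>
    rw [expect_iidSamples_succ]
    simp_rw [coverage_cons]
    push_cast
    simp_rw [expect_add, expect_const, ih]
    have h := ofReal_influence_div M S
    have h0 := influence_nonneg M S
    rw [add_mul, one_mul, add_comm (_ * _), ENNReal.ofReal_add (by positivity) (by positivity), h]
    rw [expect_ite]
    simp

/-- The exponential moments of the coverage of a fixed set. -/
lemma expect_exp_coverage_le (M : DiffusionModel G) (S : Finset V) (θ : ℕ) (s : ℝ) :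
    (expect (iidSamples (rrSample M) θ) fun R => ENNReal.ofReal (Real.exp (s * coverage R S))) ≤
      ENNReal.ofReal
        (Real.exp (θ * (influence M S / Fintype.card V) * (Real.exp s - 1))) := by
  classical
  induction θ with
  | zero => simp [iidSamples, expect_pure, coverage_nil]
  | succ θ ih =>
    rw [expect_iidSamples_succ]
    set q := influence M S / Fintype.card V with hq
    have hq0 : 0 ≤ q := div_nonneg (influence_nonneg M S) (Nat.cast_nonneg _)
    have hq1 : q ≤ 1 := influence_div_le_one M S
    have hstep : ∀ (r : Finset V) (L : List (Finset V)),
        ENNReal.ofReal (Real.exp (s * coverage (r :: L) S)) =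
          (if ∃ v ∈ S, v ∈ r then ENNReal.ofReal (Real.exp s) else 1) *
            ENNReal.ofReal (Real.exp (s * coverage L S)) := by
      intro r L
      rw [coverage_cons]
      split_ifs
      · rw [← ENNReal.ofReal_mul (Real.exp_pos _).le, ← Real.exp_add]
        push_cast; ring_nf
      · simp
    simp_rw [hstep, expect_const_mul, mul_comm _ (expect _ _), expect_const_mul]
    rw [expect_ite, prob_not, ← ofReal_influence_div, ← hq]
    have h2 : ENNReal.ofReal (Real.exp s) * ENNReal.ofReal q + 1 * (1 - ENNReal.ofReal q) ≤
        ENNReal.ofReal (Real.exp (q * (Real.exp s - 1))) := by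
      rw [one_mul, ← ENNReal.ofReal_one, ← ENNReal.ofReal_sub _ hq0,
        ← ENNReal.ofReal_mul (Real.exp_pos _).le, ← ENNReal.ofReal_add (by positivity)
        (by linarith)]
      refine ENNReal.ofReal_le_ofReal ?_
      have := Real.add_one_le_exp (q * (Real.exp s - 1))
      linarith
    refine (mul_le_mul' ih h2).trans (le_of_eq ?_)
    rw [← ENNReal.ofReal_mul (Real.exp_pos _).le, ← Real.exp_add]
    push_cast; ring_nf

/-- Chernoff's bound in exponential form. -/
lemma prob_le_coverage_le (M : DiffusionModel G) (S : Finset V) (θ : ℕ) (s c : ℝ) :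
    prob (iidSamples (rrSample M) θ) (fun R => c ≤ s * coverage R S) ≤
      ENNReal.ofReal
        (Real.exp (θ * (influence M S / Fintype.card V) * (Real.exp s - 1) - c)) := by
  refine (prob_le_expect_exp _ _ c).trans ?_
  refine (mul_le_mul_right (expect_exp_coverage_le M S θ s) _).trans (le_of_eq ?_)
  rw [← ENNReal.ofReal_mul (Real.exp_pos _).le, ← Real.exp_add]
  ring_nf

lemma card_le_of_mem_support_selectSeeds {m k : ℕ} [NeZero m] {δ : ℝ} (hδ : 0 < δ)
    (arrival : List (Finset V) → (V → Fin m) → List V → List V) (R : List (Finset V))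
    (S : Finset V) (hS : S ∈ (selectSeeds m k δ arrival R).support) : S.card ≤ k := by
  rw [selectSeeds, PMF.support_map] at hS
  obtain ⟨part, -, rfl⟩ := hS
  exact card_roundOutput_le arrival R part hδ

/-- Some set of at most `k` vertices is estimated to be more influential than `x` by the factor
`1 + ε`. -/
def Overestimates (k : ℕ) (ε x : ℝ) (R : List (Finset V)) : Prop :=
  ∃ S : Finset V, S.card ≤ k ∧ R.length * ((1 + ε) * x) ≤ Fintype.card V * coverage R S

lemma prob_overestimates_le (M : DiffusionModel G) {k : ℕ} (hk : k ≤ Fintype.card V) {ε x : ℝ}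
    (hε : 0 < ε) (hx : optInfluence M k ≤ x) (hx0 : 0 ≤ x) (θ : ℕ) :
    prob (iidSamples (rrSample M) θ) (Overestimates k ε x) ≤
      (Fintype.card V).choose k * ENNReal.ofReal
        (Real.exp (-(θ * (x / Fintype.card V) * (ε ^ 2 / (2 + 2 / 3 * ε))))) := by
  have hn : (0 : ℝ) < Fintype.card V := by exact_mod_cast Fintype.card_pos
  -- Bernstein's choice: 1 - s/3 = 1/(1 + ε/3), so the quadratic term is exactly half of sε.
  set s := ε / (1 + ε / 3) with hs
  have hs0 : 0 ≤ s := by positivity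
  have hs3 : s < 3 := by rw [hs, div_lt_iff₀ (by positivity)]; linarith
  have hbern : Real.exp s - 1 - s * (1 + ε) ≤ -(ε ^ 2 / (2 + 2 / 3 * ε)) := by
    have h := exp_le_of_lt_three hs0 hs3
    have e1 : s ^ 2 / (2 * (1 - s / 3)) = ε ^ 2 / (2 + 2 / 3 * ε) := by
      have : 1 - s / 3 = 1 / (1 + ε / 3) := by rw [hs]; field_simp; ring
      rw [this, hs]; field_simp
    have e2 : s * ε = 2 * (ε ^ 2 / (2 + 2 / 3 * ε)) := by
      rw [hs]; field_simp
    rw [e1] at h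
    linarith
  have hsub : prob (iidSamples (rrSample M) θ) (Overestimates k ε x) ≤
      prob (iidSamples (rrSample M) θ) (fun R => ∃ S ∈ Finset.powersetCard k Finset.univ,
        s * (1 + ε) * (θ * (x / Fintype.card V)) ≤ s * coverage R S) := by
    refine prob_mono_support _ fun R hR hover => ?_
    obtain ⟨S, hS, h⟩ := hover
    -- The comparison value x does not depend on the set, so enlarging to exactly k vertices keeps
    -- the event and the union bound costs a single binomial coefficient.
    obtain ⟨T, hST, hT⟩ := Finset.exists_superset_card_eq hS (by simpa using hk)
    refine ⟨T, Finset.mem_powersetCard.2 ⟨Finset.subset_univ _, hT⟩, ?_⟩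
    rw [length_of_mem_support_iidSamples _ _ R hR] at h
    have hST' : (coverage R S : ℝ) ≤ coverage R T := by exact_mod_cast coverage_mono R hST
    rw [mul_assoc]
    refine mul_le_mul_of_nonneg_left (le_trans ?_ hST') hs0
    have : (1 + ε) * (θ * (x / Fintype.card V)) = θ * ((1 + ε) * x) / Fintype.card V := by ring
    rw [this, div_le_iff₀ hn]
    linarith
  refine hsub.trans ((prob_exists_le _ _ _).trans ?_)
  refine (Finset.sum_le_card_nsmul _ _ _ fun S hS => ?_).trans
    (by rw [Finset.card_powersetCard, Finset.card_univ, nsmul_eq_mul])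
  refine (prob_le_coverage_le M S θ s _).trans (ENNReal.ofReal_le_ofReal (Real.exp_le_exp.2 ?_))
  have hσ : influence M S / Fintype.card V ≤ x / Fintype.card V :=
    div_le_div_of_nonneg_right ((influence_le_optInfluence M
      (Finset.mem_powersetCard.1 hS).2.le).trans hx) hn.le
  have h1 : 0 ≤ Real.exp s - 1 := by have := Real.add_one_le_exp s; linarith
  have h2 : θ * (influence M S / Fintype.card V) * (Real.exp s - 1) ≤
      θ * (x / Fintype.card V) * (Real.exp s - 1) :=
    mul_le_mul_of_nonneg_right (mul_le_mul_of_nonneg_left hσ (Nat.cast_nonneg _)) h1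
  have h3 := mul_le_mul_of_nonneg_left hbern (show 0 ≤ θ * (x / Fintype.card V) by positivity)
  linarith

/-- The estimation rounds return a wrong bound only if the samples of one of them overestimate. -/
lemma prob_martingaleRounds_le (M : DiffusionModel G) {m k : ℕ} [NeZero m] (hk : 1 ≤ k) {δ ε : ℝ}
    (hδ : 0 < δ) (hε : 0 < ε)
    (arrival : List (Finset V) → (V → Fin m) → List V → List V) (fuel i θ : ℕ)
    (R : List (Finset V)) (hθ : 0 < θ) (hR : R.length ≤ θ) :
    prob (martingaleRounds M m k δ ε arrival fuel i θ R)
        (fun LB => ¬ (0 < LB ∧ LB ≤ optInfluence M k)) ≤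
      ∑ j ∈ Finset.range fuel, prob (iidSamples (rrSample M) (2 ^ j * θ - R.length)) fun L =>
        Overestimates k ε (max (optInfluence M k) (Fintype.card V / 2 ^ (i + j))) (R ++ L) := by
  classical
  induction fuel generalizing i θ R with
  | zero =>
    have := one_le_optInfluence M hk
    simp [martingaleRounds, prob, expect_pure, this]
  | succ fuel ih =>
    have hn : (0 : ℝ) < Fintype.card V := by exact_mod_cast Fintype.card_pos
    rw [martingaleRounds, prob_bind, Finset.sum_range_succ']
    have key : ∀ new ∈ (iidSamples (rrSample M) (θ - R.length)).support,
        prob ((selectSeeds m k δ arrival (R ++ new)).bind fun S =>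
          let est : ℝ := Fintype.card V * coverage (R ++ new) S / (R ++ new).length
          open Classical in
          if (1 + ε) * (Fintype.card V / 2 ^ i) ≤ est then PMF.pure (est / (1 + ε))
          else martingaleRounds M m k δ ε arrival fuel (i + 1) (2 * θ) (R ++ new))
            (fun LB => ¬ (0 < LB ∧ LB ≤ optInfluence M k)) ≤
        ∑ j ∈ Finset.range fuel, prob (iidSamples (rrSample M) (2 ^ j * (2 * θ) - θ)) (fun L =>
          Overestimates k ε (max (optInfluence M k) (Fintype.card V / 2 ^ (i + 1 + j)))
            (R ++ new ++ L)) +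
        if Overestimates k ε (max (optInfluence M k) (Fintype.card V / 2 ^ i)) (R ++ new)
          then 1 else 0 := by
      intro new hnew
      have hlen : (R ++ new).length = θ := by
        rw [List.length_append, length_of_mem_support_iidSamples _ _ _ hnew]; omega
      have hlen0 : (0 : ℝ) < (R ++ new).length := by rw [hlen]; exact_mod_cast hθ
      rw [prob_bind]
      refine (expect_mono_support _ fun S hS => ?_).trans (expect_const _ _).le
      have hSk := card_le_of_mem_support_selectSeeds hδ arrival _ S hS
      dsimp only
      split_ifs with hest hover hover
      · exact (prob_le_one _ _).trans le_add_self
      · refine le_trans (le_of_eq ?_) zero_le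
        simp only [prob, expect_pure, ite_eq_right_iff, one_ne_zero, imp_false, not_not]
        have hpos : 0 < (1 + ε) * (Fintype.card V / 2 ^ i : ℝ) := by positivity
        refine ⟨div_pos (hpos.trans_le hest) (by linarith), ?_⟩
        -- A returned bound above the optimum puts the estimate above (1+ε) OPT, and the stopping
        -- test puts it above (1+ε) n/2^i: S witnesses an overestimate of the maximum.
        by_contra hlt
        rw [not_le, lt_div_iff₀ (by linarith)] at hlt
        refine hover ⟨S, hSk, ?_⟩
        rw [mul_comm, ← le_div_iff₀ hlen0, mul_max_of_nonneg _ _ (by linarith)]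
        exact max_le (by linarith) hest
      · exact (prob_le_one _ _).trans le_add_self
      · rw [add_zero]
        have := ih (i + 1) (2 * θ) (R ++ new) (by omega) (by omega)
        rwa [hlen] at this
    refine (expect_mono_support _ key).trans (le_of_eq ?_)
    rw [expect_add, expect_sum]
    congr 1
    · refine Finset.sum_congr rfl fun j _ => ?_
      -- Samples are kept, so those of a later round are the new ones of this round followed by
      -- further independent ones. The bound for that round thus refers to plain independent
      -- samples, not conditioned on continuing.
      have hsplit : 2 ^ (j + 1) * θ - R.length =
          (θ - R.length) + (2 ^ j * (2 * θ) - θ) := by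
        have : θ ≤ 2 ^ j * (2 * θ) := by
          have := Nat.one_le_two_pow (n := j)
          nlinarith
        rw [pow_succ, mul_assoc]
        omega
      rw [hsplit]
      simp only [prob]
      rw [expect_iidSamples_add]
      simp only [List.append_assoc, Nat.add_assoc, Nat.add_comm 1 j]
    · simp [prob]

/-- The estimation phase returns a positive lower bound on the optimum, with the prescribed
probability. -/
lemma prob_lowerBound_le (M : DiffusionModel G) {m k : ℕ} [NeZero m] (hk : 1 ≤ k)
    (hkn : 2 * k ≤ Fintype.card V) {δ ε η : ℝ} (hδ : 0 < δ) (hε : 0 < ε) (hη : 0 < η)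
    (hη' : η < 1) (arrival : List (Finset V) → (V → Fin m) → List V → List V) :
    prob (lowerBound M m k δ ε η arrival) (fun LB => ¬ (0 < LB ∧ LB ≤ optInfluence M k)) ≤
      ENNReal.ofReal η := by
  set n := Fintype.card V with hn_def
  have hn2 : 2 ≤ n := by omega
  have hn : (0 : ℝ) < n := by exact_mod_cast (by omega : 0 < n)
  have hε' : 0 < √2 * ε := by positivity
  have hlog2 : 1 ≤ Real.logb 2 n := by
    rw [Real.le_logb_iff_rpow_le (by norm_num) hn]
    simpa using (by exact_mod_cast hn2 : (2 : ℝ) ≤ n)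
  have hchoose : (0 : ℝ) < n.choose k := by
    exact_mod_cast Nat.choose_pos (by omega)
  have hchoose1 : (1 : ℝ) ≤ n.choose k := by
    exact_mod_cast Nat.choose_pos (by omega : k ≤ n)
  set l := Real.log (n.choose k) + Real.log (1 / η) + Real.log (Real.logb 2 n) with hl
  have hl0 : 0 < l := by
    have h1 := Real.log_nonneg hchoose1
    have h2 : 0 < Real.log (1 / η) := Real.log_pos (by rw [lt_div_iff₀ hη]; linarith)
    have h3 := Real.log_nonneg hlog2
    linarith
  have hlam : lamPrime n k (√2 * ε) η = (2 + 2 / 3 * (√2 * ε)) * l * n / (√2 * ε) ^ 2 := rfl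
  have hlam0 : 0 < lamPrime n k (√2 * ε) η := by rw [hlam]; positivity
  set θ := ⌈2 * lamPrime n k (√2 * ε) η / n⌉₊ with hθ
  have hθ0 : 0 < θ := Nat.ceil_pos.2 (by positivity)
  have hexp : Real.exp (-l) = η / (n.choose k * Real.logb 2 n) := by
    rw [hl, neg_add, neg_add, Real.exp_add, Real.exp_add, Real.exp_neg, Real.exp_neg,
      Real.exp_neg, Real.exp_log hchoose, Real.exp_log (by positivity),
      Real.exp_log (by linarith)]
    field_simp
  have hround : ∀ j : ℕ, prob (iidSamples (rrSample M) (2 ^ j * θ)) (Overestimates k (√2 * ε)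
      (max (optInfluence M k) (n / 2 ^ (1 + j)))) ≤
        ENNReal.ofReal (η / Real.logb 2 n) := by
    intro j
    have hx0 : (0 : ℝ) ≤ max (optInfluence M k) (n / 2 ^ (1 + j)) :=
      le_max_of_le_right (by positivity)
    refine (prob_overestimates_le M (by omega) hε' (le_max_left _ _) hx0 _).trans ?_
    -- The doubling of the samples offsets the halving of the guess n/2^(1+j); the remaining factor
    -- 1/2 is the reason for the 2 in ⌈2λ'/n⌉.
    have hge : l ≤ ((2 ^ j * θ : ℕ) : ℝ) * (max (optInfluence M k) (n / 2 ^ (1 + j)) / n) *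
        ((√2 * ε) ^ 2 / (2 + 2 / 3 * (√2 * ε))) := by
      have h1 : 2 * lamPrime n k (√2 * ε) η / n ≤ θ := Nat.le_ceil _
      have h2 : 1 / 2 ^ (1 + j) ≤ max (optInfluence M k) (n / 2 ^ (1 + j)) / n := by
        rw [le_div_iff₀ hn]
        refine le_trans (le_of_eq ?_) (le_max_right _ _)
        ring
      calc l = (2 ^ j * (2 * lamPrime n k (√2 * ε) η / n)) * (1 / 2 ^ (1 + j)) *
            ((√2 * ε) ^ 2 / (2 + 2 / 3 * (√2 * ε))) := by
              rw [hlam, pow_add, pow_one]; field_simp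
        _ ≤ _ := by
              push_cast
              gcongr
    have h2 : (((n.choose k : ℕ) : ℝ≥0∞)) = ENNReal.ofReal (n.choose k) :=
      (ENNReal.ofReal_natCast _).symm
    rw [h2, ← ENNReal.ofReal_mul hchoose.le]
    refine ENNReal.ofReal_le_ofReal ?_
    calc (n.choose k : ℝ) * Real.exp (-_) ≤ n.choose k * Real.exp (-l) :=
          mul_le_mul_of_nonneg_left (Real.exp_le_exp.2 (neg_le_neg hge)) hchoose.le
      _ = η / Real.logb 2 n := by rw [hexp]; field_simp
  have hmain := prob_martingaleRounds_le M hk hδ hε' arrival (Nat.log 2 n) 1 θ [] hθ0 (by simp)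
  refine hmain.trans ?_
  simp only [List.length_nil, Nat.sub_zero, List.nil_append]
  refine (Finset.sum_le_card_nsmul _ _ _ fun j _ => hround j).trans ?_
  rw [Finset.card_range, nsmul_eq_mul, ← ENNReal.ofReal_natCast, ← ENNReal.ofReal_mul
    (Nat.cast_nonneg _)]
  refine ENNReal.ofReal_le_ofReal ?_
  -- There are ⌊log₂ n⌋ rounds, each failing with probability at most η/log₂ n.
  have h1 : (Nat.log 2 n : ℝ) ≤ Real.logb 2 n := by
    simpa using Real.natLog_le_logb n 2
  rw [← mul_div_assoc, div_le_iff₀ (by linarith)]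
  nlinarith

end Concentration

/-! ## The approximation guarantee -/

section Constants

lemma one_sub_inv_exp_bounds :
    (0.63 : ℝ) ≤ 1 - 1 / Real.exp 1 ∧ 1 - 1 / Real.exp 1 ≤ 0.635 := by
  have h1 := Real.exp_one_gt_d9
  have h2 := Real.exp_one_lt_d9
  have h3 : 1 / Real.exp 1 ≤ 0.37 := by
    rw [div_le_iff₀ (Real.exp_pos 1)]; linarith
  have h4 : 0.365 ≤ 1 / Real.exp 1 := by
    rw [le_div_iff₀ (Real.exp_pos 1)]; linarith
  constructor <;> linarith

lemma ratio_bounds {δ : ℝ} (hδ : 0 < δ) (hδ' : δ < 1 / 2) : 0 ≤ ratio δ ∧ ratio δ ≤ 0.28 := by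
  obtain ⟨h1, h2⟩ := one_sub_inv_exp_bounds
  unfold ratio
  set α := 1 - 1 / Real.exp 1
  have hβ : 0 < 1 / 2 - δ := by linarith
  refine ⟨by positivity, ?_⟩
  rw [div_le_iff₀ (by linarith)]
  nlinarith

/-- The consequence of the definition of `λ*` that the guarantee needs. -/
lemma le_of_lamStar_le {n k : ℕ} (hn : 0 < n) (hkn : k ≤ n) {ε η Λ : ℝ} (hε : 0 < ε)
    (hη : 0 < η) (hη' : η < 1) (h : lamStar n k ε η ≤ n * Λ) :
    2 * (0.63 * Real.log (n.choose k) + 1.8 * Real.log (2 / η)) ≤ ε ^ 2 * Λ := by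
  obtain ⟨h1, -⟩ := one_sub_inv_exp_bounds
  have hα1 : 1 - 1 / Real.exp 1 ≤ 1 := by have := Real.exp_pos 1; simp; positivity
  unfold lamStar at h
  set α := 1 - 1 / Real.exp 1
  have hn' : (0 : ℝ) < n := by exact_mod_cast hn
  have hc : 0 ≤ Real.log (n.choose k) :=
    Real.log_nonneg (by exact_mod_cast Nat.choose_pos hkn)
  have hL : 0 ≤ Real.log (2 / η) := Real.log_nonneg (by rw [le_div_iff₀ hη]; linarith)
  set c := Real.log (n.choose k)
  set L := Real.log (2 / η)
  rw [div_le_iff₀ (by positivity)] at h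
  have h2 : 2 * (α * √L + √(α * (c + L))) ^ 2 ≤ ε ^ 2 * Λ := by
    refine le_of_mul_le_mul_left ?_ hn'
    linarith
  refine le_trans ?_ h2
  have e1 : √L ^ 2 = L := Real.sq_sqrt hL
  have e2 : √(α * (c + L)) ^ 2 = α * (c + L) := Real.sq_sqrt (by positivity)
  -- The cross term of the square contributes 2α²L, so the coefficient of L is α + 3α² ≥ 1.8.
  have e3 : α * L ≤ √L * √(α * (c + L)) := by
    rw [← Real.sqrt_mul hL]
    refine Real.le_sqrt_of_sq_le ?_
    have : α * L * (α * L) ≤ 1 * L * (α * (c + L)) := by gcongr; linarith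
    nlinarith
  have e4 : 0.63 * c ≤ α * c := mul_le_mul_of_nonneg_right h1 hc
  have e5 : 1.8 * L ≤ (α + 3 * α ^ 2) * L := mul_le_mul_of_nonneg_right (by nlinarith) hL
  have e6 : α * (α * L) ≤ α * (√L * √(α * (c + L))) :=
    mul_le_mul_of_nonneg_left e3 (by linarith)
  nlinarith

/-- The Bernstein remainder has a pole at ε = 1, compensated by z ≤ 0.28 (1 - ε); this leaves
(9/2)·0.28 ε² = 3ε·0.42ε. -/
lemma exp_sub_one_mul_le {ε z a : ℝ} (hε : 0 < ε) (hε1 : ε < 1) (ha : 0.28 ≤ a) (hz0 : 0 ≤ z)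
    (hz : z ≤ 0.28 - a * ε) :
    (Real.exp (3 * ε) - 1) * z ≤ 3 * ε * (z + 0.42 * ε) := by
  have h := exp_le_of_lt_three (s := 3 * ε) (by linarith) (by linarith)
  have h1 : 0 < 1 - ε := by linarith
  have h2 : (3 * ε) ^ 2 / (2 * (1 - 3 * ε / 3)) = 9 / 2 * ε ^ 2 / (1 - ε) := by
    rw [mul_div_cancel_left₀ ε three_ne_zero]; field_simp; norm_num
  rw [h2] at h
  have h3 : z / (1 - ε) ≤ 0.28 := by
    rw [div_le_iff₀ h1]; nlinarith
  have h4 : (Real.exp (3 * ε) - 1) * z ≤ (3 * ε + 9 / 2 * ε ^ 2 / (1 - ε)) * z :=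
    mul_le_mul_of_nonneg_right (by linarith) hz0
  have h5 : (3 * ε + 9 / 2 * ε ^ 2 / (1 - ε)) * z =
      3 * ε * z + 9 / 2 * ε ^ 2 * (z / (1 - ε)) := by ring
  have h6 : 9 / 2 * ε ^ 2 * (z / (1 - ε)) ≤ 9 / 2 * ε ^ 2 * 0.28 :=
    mul_le_mul_of_nonneg_left h3 (by positivity)
  nlinarith

/-- If z fell short by more than 0.84ε, half of the gap would survive the remainder 0.42ε, giving
1.26 ε²Λ ≤ 1.5c + 1; but 1.26·(1.26c + 3.6L) is larger. -/
lemma le_of_mean_bound {ε ρ c L Λ z : ℝ} (hε : 0 < ε) (hερ : ε < ρ) (hρ : ρ ≤ 0.28)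
    (hc : 0 ≤ c) (hL : 0.69 ≤ L) (hΛ : 2 * (0.63 * c + 1.8 * L) ≤ ε ^ 2 * Λ) (hΛ0 : 0 ≤ Λ)
    (hz : 0 ≤ z)
    (h : 3 * ε * (ρ * Λ) ≤ (Real.exp (3 * ε) - 1) * (Λ * z) + (3 / 2 * c + 1)) :
    ρ - 0.84 * ε ≤ z := by
  by_contra hlt
  rw [not_le] at hlt
  have h1 := exp_sub_one_mul_le (a := 0.84) hε (by linarith) (by norm_num) hz (by linarith)
  have h2 := mul_le_mul_of_nonneg_left h1 hΛ0
  have h3 : Λ * (3 * ε * (ρ - z - 0.42 * ε)) ≤ 3 / 2 * c + 1 := by linarith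
  have h4 : Λ * (3 * ε * (0.42 * ε)) ≤ Λ * (3 * ε * (ρ - z - 0.42 * ε)) := by
    refine mul_le_mul_of_nonneg_left ?_ hΛ0
    exact mul_le_mul_of_nonneg_left (by linarith) (by linarith)
  nlinarith

/-- Of a gap ε at least 0.53ε survives the remainder 0.42ε and the lower-tail loss 0.15ερ. Then 1.59
ε²Λ ≤ 1.5c + L + 10ρL ≤ 1.5c + 3.8L, against 1.59·(1.26c + 3.6L). -/
lemma le_of_tail_bound {ε ρ c L Λ z : ℝ} (hε : 0 < ε) (hερ : ε < ρ) (hρ : ρ ≤ 0.28)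
    (hc : 0 ≤ c) (hL : 0 < L) (hΛ : 2 * (0.63 * c + 1.8 * L) ≤ ε ^ 2 * Λ) (hΛ0 : 0 ≤ Λ)
    (hz : 0 ≤ z)
    (h : 3 * ε * (ρ * (Λ * (1 - 0.15 * ε) - L / (0.3 * ε))) ≤
      (Real.exp (3 * ε) - 1) * (Λ * z) + (3 / 2 * c + L)) :
    ρ - ε ≤ z := by
  by_contra hlt
  rw [not_le] at hlt
  have h1 := exp_sub_one_mul_le (a := 1) hε (by linarith) (by norm_num) hz (by linarith)
  have h2 := mul_le_mul_of_nonneg_left h1 hΛ0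
  have h0 : 3 * ε * (ρ * (Λ * (1 - 0.15 * ε) - L / (0.3 * ε))) =
      3 * ε * (ρ * (Λ * (1 - 0.15 * ε))) - 10 * (ρ * L) := by
    field_simp; ring
  rw [h0] at h
  have h3 : Λ * (3 * ε * (ρ - z - 0.42 * ε - 0.15 * ε * ρ)) ≤ 3 / 2 * c + L + 10 * (ρ * L) := by
    linarith
  have h4 : Λ * (3 * ε * (0.53 * ε)) ≤ Λ * (3 * ε * (ρ - z - 0.42 * ε - 0.15 * ε * ρ)) := by
    refine mul_le_mul_of_nonneg_left ?_ hΛ0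
    exact mul_le_mul_of_nonneg_left (by nlinarith) (by linarith)
  have h5 : ρ * L ≤ 0.28 * L := mul_le_mul_of_nonneg_right hρ hL.le
  nlinarith

/-- Because (1 + t + t²/2)(1 - t + t²/2) = 1 + t⁴/4 ≥ 1. -/
lemma exp_neg_le {t : ℝ} (ht : 0 ≤ t) : Real.exp (-t) ≤ 1 - t + t ^ 2 / 2 := by
  have h := Real.quadratic_le_exp_of_nonneg ht
  rw [Real.exp_neg, inv_le_comm₀ (Real.exp_pos t) (by nlinarith [sq_nonneg (t - 1)])]
  refine le_trans ?_ h
  rw [inv_le_iff_one_le_mul₀ (by nlinarith [sq_nonneg (t - 1)])]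
  nlinarith [sq_nonneg (t ^ 2)]

end Constants

/-! ### From coverage to influence: mean and high-probability guarantees. -/

section Guarantee

variable {V : Type*} [Fintype V] [LinearOrder V] [Nonempty V] {G : Digraph V}

lemma expectedInfluence_eq (M : DiffusionModel G) (p : PMF (Finset V)) :
    expectedInfluence M p = (expect p fun S => ENNReal.ofReal (influence M S)).toReal :=
  (toReal_expect_ofReal p _ (influence_nonneg M)).symm

lemma expect_influence_ne_top (M : DiffusionModel G) (p : PMF (Finset V)) :
    (expect p fun S => ENNReal.ofReal (influence M S)) ≠ ∞ := by
  rw [expect_fintype]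
  exact ENNReal.sum_ne_top.2 fun S _ =>
    ENNReal.mul_ne_top (p.apply_ne_top S) ENNReal.ofReal_ne_top

lemma le_expectedInfluence_iff (M : DiffusionModel G) (p : PMF (Finset V)) (x : ℝ) :
    x ≤ expectedInfluence M p ↔
      ENNReal.ofReal x ≤ expect p fun S => ENNReal.ofReal (influence M S) := by
  rw [expectedInfluence_eq]
  constructor
  · exact fun h => ENNReal.ofReal_le_of_le_toReal h
  · intro h
    rcases le_or_gt x 0 with hx | hx
    · exact hx.trans ENNReal.toReal_nonneg
    · exact (ENNReal.ofReal_le_iff_le_toReal (expect_influence_ne_top M p)).1 h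

lemma expectedInfluence_nonneg (M : DiffusionModel G) (p : PMF (Finset V)) :
    0 ≤ expectedInfluence M p := by
  rw [expectedInfluence_eq]; exact ENNReal.toReal_nonneg

variable (M : DiffusionModel G) {m k : ℕ} [NeZero m] {δ : ℝ}
  (arrival : List (Finset V) → (V → Fin m) → List V → List V)

/-- The expected coverage of the selected seeds. -/
lemma ratio_mul_coverage_le_expect (hk : 1 ≤ k) (hδ : 0 < δ) (hδ' : δ < 1 / 2)
    (harrival : ∀ R part L, (arrival R part L).Perm L) (R : List (Finset V)) (T : Finset V)
    (hT : T.card ≤ k) :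
    ENNReal.ofReal (ratio δ) * coverage R T ≤
      expect (selectSeeds m k δ arrival R) fun S => (coverage R S : ℝ≥0∞) := by
  have h := ratio_mul_le_sum_coverage arrival R hk hδ hδ' harrival T hT
  have hP : (0 : ℝ) < Fintype.card (V → Fin m) := by exact_mod_cast Fintype.card_pos
  rw [selectSeeds, expect_map, expect_uniform,
    ENNReal.le_div_iff_mul_le (by left; exact_mod_cast hP.ne') (by simp),
    ← ENNReal.ofReal_natCast, ← ENNReal.ofReal_natCast (Fintype.card (V → Fin m)),
    ← ENNReal.ofReal_mul (ratio_bounds hδ hδ').1, ← ENNReal.ofReal_mul' (Nat.cast_nonneg _)]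
  refine (ENNReal.ofReal_le_ofReal (by linarith)).trans
    ((ENNReal.ofReal_le_ofReal h).trans (le_of_eq ?_))
  rw [ENNReal.ofReal_sum_of_nonneg fun _ _ => Nat.cast_nonneg _]
  simp

/-- The guarantee in expectation over the samples and the partition; the slack in `ε` pays for
failures of the estimation phase. -/
lemma le_expect_influence (hk : 1 ≤ k) (hkn : 2 * k ≤ Fintype.card V) {ε η : ℝ} (hδ : 0 < δ)
    (hδ' : δ < 1 / 2) (hε : 0 < ε) (hερ : ε < ratio δ) (hη : 0 < η) (hη' : η < 1)
    (harrival : ∀ R part L, (arrival R part L).Perm L) (θ : ℕ)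
    (hθ : lamStar (Fintype.card V) k ε η / optInfluence M k ≤ θ) :
    ENNReal.ofReal ((ratio δ - 0.84 * ε) * optInfluence M k) ≤
      expect (iidSamples (rrSample M) θ) fun R =>
        expect (selectSeeds m k δ arrival R) fun S => ENNReal.ofReal (influence M S) := by
  obtain ⟨hρ0, hρ⟩ := ratio_bounds hδ hδ'
  have hn : (0 : ℝ) < Fintype.card V := by exact_mod_cast Fintype.card_pos
  have hopt := one_le_optInfluence M hk
  obtain ⟨O, hO, hOopt⟩ := exists_influence_eq_optInfluence M k
  set n := Fintype.card V with hn_def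
  set opt := optInfluence M k with hopt_def
  set ρ := ratio δ
  set c := Real.log (n.choose k) with hc_def
  have hc : 0 ≤ c := Real.log_nonneg (by exact_mod_cast Nat.choose_pos (by omega : k ≤ n))
  set E := expect (iidSamples (rrSample M) θ) fun R =>
    expect (selectSeeds m k δ arrival R) fun S => ENNReal.ofReal (influence M S) with hE
  have hE' : E = expect ((iidSamples (rrSample M) θ).bind (selectSeeds m k δ arrival))
      fun S => ENNReal.ofReal (influence M S) := (expect_bind _ _ _).symm
  have hEtop : E ≠ ∞ := hE' ▸ expect_influence_ne_top M _
  have hs : 0 ≤ Real.exp (3 * ε) - 1 := by have := Real.add_one_le_exp (3 * ε); linarith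
  set g := Real.exp (3 * ε) - 1 with hg
  -- The inequality x ≤ e^x bounds the excess of C(S), and summing over all small sets makes the
  -- error independent of S, hence of how S was chosen from R.
  have hpt : ∀ (R : List (Finset V)) (S : Finset V), S.card ≤ k →
      ENNReal.ofReal (3 * ε) * (coverage R S : ℝ≥0∞) ≤
        ENNReal.ofReal (g * (θ / n)) * ENNReal.ofReal (influence M S) +
        (ENNReal.ofReal (3 / 2 * c) + ∑ T ∈ smallSets V k,
          ENNReal.ofReal (Real.exp (-(θ * (influence M T / n) * g + 3 / 2 * c))) *
            ENNReal.ofReal (Real.exp (3 * ε * coverage R T))) := by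
    intro R S hS
    have hσ := influence_nonneg M S
    rcases S.eq_empty_or_nonempty with rfl | hne
    · simp [coverage_empty]
    · have hmem : S ∈ smallSets V k := Finset.mem_filter.2 ⟨Finset.mem_univ _, hne, hS⟩
      refine le_trans ?_ (add_le_add_right (add_le_add_right
        (Finset.single_le_sum (f := fun T =>
          ENNReal.ofReal (Real.exp (-(θ * (influence M T / n) * g + 3 / 2 * c))) *
            ENNReal.ofReal (Real.exp (3 * ε * coverage R T))) (fun _ _ => zero_le) hmem) _) _)
      rw [← ENNReal.ofReal_natCast, ← ENNReal.ofReal_mul (by positivity),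
        ← ENNReal.ofReal_mul (by positivity), ← ENNReal.ofReal_mul (by positivity),
        ← Real.exp_add, ← ENNReal.ofReal_add (by positivity) (by positivity),
        ← ENNReal.ofReal_add (by positivity) (by positivity)]
      refine ENNReal.ofReal_le_ofReal ?_
      have := Real.add_one_le_exp
        (-(θ * (influence M S / n) * g + 3 / 2 * c) + 3 * ε * coverage R S)
      have e : g * (θ / n) * influence M S = θ * (influence M S / n) * g := by ring
      rw [e]
      linarith
  have hmain : ENNReal.ofReal (3 * ε * (ρ * (θ * (opt / n)))) ≤
      ENNReal.ofReal (g * (θ / n)) * E + ENNReal.ofReal (3 / 2 * c + 1) := by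
    calc ENNReal.ofReal (3 * ε * (ρ * (θ * (opt / n))))
        = expect (iidSamples (rrSample M) θ) fun R =>
          ENNReal.ofReal (3 * ε) * (ENNReal.ofReal ρ * (coverage R O : ℝ≥0∞)) := by
          rw [expect_const_mul, expect_const_mul, expect_coverage, hOopt,
            ENNReal.ofReal_mul (by positivity), ENNReal.ofReal_mul hρ0]
      _ ≤ expect (iidSamples (rrSample M) θ) fun R => expect (selectSeeds m k δ arrival R)
          fun S => ENNReal.ofReal (3 * ε) * (coverage R S : ℝ≥0∞) := by
          refine expect_mono _ fun R => ?_
          rw [expect_const_mul]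
          exact mul_le_mul_right
            (ratio_mul_coverage_le_expect arrival hk hδ hδ' harrival R O hO) _
      _ ≤ expect (iidSamples (rrSample M) θ) fun R => expect (selectSeeds m k δ arrival R)
          fun S => ENNReal.ofReal (g * (θ / n)) * ENNReal.ofReal (influence M S) +
        (ENNReal.ofReal (3 / 2 * c) + ∑ T ∈ smallSets V k,
          ENNReal.ofReal (Real.exp (-(θ * (influence M T / n) * g + 3 / 2 * c))) *
            ENNReal.ofReal (Real.exp (3 * ε * coverage R T))) :=
          expect_mono _ fun R => expect_mono_support _ fun S hS =>
            hpt R S (card_le_of_mem_support_selectSeeds hδ arrival R S hS)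
      _ = ENNReal.ofReal (g * (θ / n)) * E + (ENNReal.ofReal (3 / 2 * c) +
          ∑ T ∈ smallSets V k,
          ENNReal.ofReal (Real.exp (-(θ * (influence M T / n) * g + 3 / 2 * c))) *
            expect (iidSamples (rrSample M) θ) fun R =>
              ENNReal.ofReal (Real.exp (3 * ε * coverage R T))) := by
          simp_rw [expect_add, expect_const_mul, expect_const]
          rw [expect_sum]
          simp_rw [expect_const_mul]
          rfl
      _ ≤ _ := by
          -- Each exponential has mean at most exp(-3c/2), and there are at most exp(3c/2) sets: the
          -- total error is at most 1.
          rw [ENNReal.ofReal_add (by positivity) zero_le_one]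
          refine add_le_add_right (add_le_add_right ?_ _) _
          have hterm : ∀ T ∈ smallSets V k,
              ENNReal.ofReal (Real.exp (-(θ * (influence M T / n) * g + 3 / 2 * c))) *
                (expect (iidSamples (rrSample M) θ) fun R =>
                  ENNReal.ofReal (Real.exp (3 * ε * coverage R T))) ≤
              ENNReal.ofReal (Real.exp (-(3 / 2 * c))) := by
            intro T _
            refine (mul_le_mul_right (expect_exp_coverage_le M T θ (3 * ε)) _).trans ?_
            rw [← ENNReal.ofReal_mul (Real.exp_pos _).le, ← Real.exp_add]
            refine ENNReal.ofReal_le_ofReal (Real.exp_le_exp.2 (le_of_eq ?_))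
            ring
          refine (Finset.sum_le_card_nsmul _ _ _ hterm).trans ?_
          rw [nsmul_eq_mul, ← ENNReal.ofReal_natCast, ← ENNReal.ofReal_mul (Nat.cast_nonneg _)]
          refine ENNReal.ofReal_le_ofReal ?_
          rw [Real.exp_neg, ← div_eq_mul_inv, div_le_one (Real.exp_pos _)]
          exact card_smallSets_le_exp V hk hkn
  rw [ENNReal.ofReal_le_iff_le_toReal hEtop]
  set y := E.toReal with hy
  have hy0 : 0 ≤ y := ENNReal.toReal_nonneg
  have hreal : 3 * ε * (ρ * (θ * (opt / n))) ≤ g * (θ / n) * y + (3 / 2 * c + 1) := by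
    rw [← ENNReal.ofReal_toReal hEtop, ← ENNReal.ofReal_mul (by positivity),
      ← ENNReal.ofReal_add (by positivity) (by positivity)] at hmain
    exact (ENNReal.ofReal_le_ofReal_iff (by positivity)).1 hmain
  have hopt0 : 0 < opt := by linarith
  have hlam : lamStar n k ε η ≤ n * (θ * (opt / n)) := by
    rw [div_le_iff₀ hopt0] at hθ
    refine hθ.trans (le_of_eq ?_)
    field_simp
  have hΛ := le_of_lamStar_le (by omega) (by omega) hε hη hη' hlam
  have hL : 0.69 ≤ Real.log (2 / η) := by
    have h1 := Real.log_two_gt_d9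
    have h2 := Real.log_le_log two_pos
      (show 2 ≤ 2 / η by rw [le_div_iff₀ hη]; linarith)
    linarith
  have hz := le_of_mean_bound (z := y / opt) hε hερ hρ hc hL hΛ (by positivity) (by positivity) (by
    refine hreal.trans (le_of_eq ?_)
    rw [← hg]
    field_simp)
  rwa [le_div_iff₀ hopt0] at hz

/-- The guarantee with high probability over the samples. -/
lemma prob_not_le_expectedInfluence (hk : 1 ≤ k) (hkn : 2 * k ≤ Fintype.card V) {ε η : ℝ}
    (hδ : 0 < δ) (hδ' : δ < 1 / 2) (hε : 0 < ε) (hη : 0 < η) (hη' : η < 1)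
    (harrival : ∀ R part L, (arrival R part L).Perm L) (θ : ℕ)
    (hθ : lamStar (Fintype.card V) k ε η / optInfluence M k ≤ θ) :
    prob (iidSamples (rrSample M) θ) (fun R => ¬ (ratio δ - ε) * optInfluence M k ≤
      expectedInfluence M (selectSeeds m k δ arrival R)) ≤ ENNReal.ofReal η := by
  obtain ⟨hρ0, hρ⟩ := ratio_bounds hδ hδ'
  have hn : (0 : ℝ) < Fintype.card V := by exact_mod_cast Fintype.card_pos
  have hopt := one_le_optInfluence M hk
  have hopt0 : 0 < optInfluence M k := by linarith
  -- For ε ≥ ρ the target is not positive; otherwise ε < 0.28, as the numerical lemmas require.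
  rcases le_or_gt (ratio δ) ε with hερ | hερ
  · have h : ∀ R : List (Finset V), (ratio δ - ε) * optInfluence M k ≤
        expectedInfluence M (selectSeeds m k δ arrival R) := fun R =>
      (mul_nonpos_of_nonpos_of_nonneg (by linarith) hopt0.le).trans
        (expectedInfluence_nonneg M _)
    simp [h, prob, expect_const]
  obtain ⟨O, hO, hOopt⟩ := exists_influence_eq_optInfluence M k
  set n := Fintype.card V with hn_def
  set opt := optInfluence M k with hopt_def
  set ρ := ratio δ with hρ_def
  set c := Real.log (n.choose k) with hc_def
  have hc : 0 ≤ c := Real.log_nonneg (by exact_mod_cast Nat.choose_pos (by omega : k ≤ n))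
  set L := Real.log (2 / η) with hL_def
  have hL : 0 < L := Real.log_pos (by rw [lt_div_iff₀ hη]; linarith)
  have hexpL : Real.exp (-L) = η / 2 := by
    rw [hL_def, Real.exp_neg, Real.exp_log (by positivity), inv_div]
  have hs : 0 ≤ Real.exp (3 * ε) - 1 := by have := Real.add_one_le_exp (3 * ε); linarith
  set g := Real.exp (3 * ε) - 1 with hg
  set t := 0.3 * ε with ht
  have ht0 : 0 < t := by positivity
  have hlam : lamStar n k ε η ≤ n * (θ * (opt / n)) := by
    rw [div_le_iff₀ hopt0] at hθ
    refine hθ.trans (le_of_eq ?_)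
    field_simp
  have hΛ := le_of_lamStar_le (by omega) (by omega) hε hη hη' hlam
  set Λ := θ * (opt / n) with hΛ_def
  have hΛ0 : 0 ≤ Λ := by positivity
  -- Deterministic part: no upper deviation of a small set and no lower deviation of O force the
  -- bound on the mean over the partition. The two failures get η/2 each; t = 0.3ε is the
  -- exponential parameter of the lower tail.
  have hdet : ∀ R : List (Finset V),
      (∀ S ∈ smallSets V k,
        3 * ε * coverage R S ≤ θ * (influence M S / n) * g + (3 / 2 * c + L)) →
      Λ * (1 - Real.exp (-t)) - L ≤ t * coverage R O →
      (ρ - ε) * opt ≤ expectedInfluence M (selectSeeds m k δ arrival R) := by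
    intro R h1 h2
    set y := expectedInfluence M (selectSeeds m k δ arrival R) with hy
    have hy0 : 0 ≤ y := expectedInfluence_nonneg M _
    have h3 : ENNReal.ofReal (3 * ε) * (ENNReal.ofReal ρ * (coverage R O : ℝ≥0∞)) ≤
        ENNReal.ofReal (g * (θ / n) * y + (3 / 2 * c + L)) := by
      calc ENNReal.ofReal (3 * ε) * (ENNReal.ofReal ρ * (coverage R O : ℝ≥0∞))
          ≤ expect (selectSeeds m k δ arrival R) fun S =>
            ENNReal.ofReal (3 * ε) * (coverage R S : ℝ≥0∞) := by
            rw [expect_const_mul]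
            exact mul_le_mul_right
              (ratio_mul_coverage_le_expect arrival hk hδ hδ' harrival R O hO) _
        _ ≤ expect (selectSeeds m k δ arrival R) fun S =>
            ENNReal.ofReal (g * (θ / n)) * ENNReal.ofReal (influence M S) +
              ENNReal.ofReal (3 / 2 * c + L) := by
            refine expect_mono_support _ fun S hS => ?_
            have hSk := card_le_of_mem_support_selectSeeds hδ arrival R S hS
            have hσ := influence_nonneg M S
            rcases S.eq_empty_or_nonempty with rfl | hne
            · simp [coverage_empty]
            · rw [← ENNReal.ofReal_natCast, ← ENNReal.ofReal_mul (by positivity),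
                ← ENNReal.ofReal_mul (by positivity),
                ← ENNReal.ofReal_add (by positivity) (by positivity)]
              refine ENNReal.ofReal_le_ofReal ((h1 S (Finset.mem_filter.2
                ⟨Finset.mem_univ _, hne, hSk⟩)).trans (le_of_eq ?_))
              ring
        _ = _ := by
            rw [expect_add, expect_const_mul, expect_const,
              ENNReal.ofReal_add (p := g * (θ / n) * y) (by positivity) (by positivity),
              ENNReal.ofReal_mul (p := g * (θ / n)) (by positivity), hy, expectedInfluence_eq,
              ENNReal.ofReal_toReal (expect_influence_ne_top M _)]
    rw [← ENNReal.ofReal_natCast, ← ENNReal.ofReal_mul hρ0,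
      ← ENNReal.ofReal_mul (by positivity),
      ENNReal.ofReal_le_ofReal_iff (by positivity)] at h3
    have h4 := mul_le_mul_of_nonneg_left (exp_neg_le ht0.le) hΛ0
    have h5 : Λ * (1 - 0.15 * ε) - L / t ≤ coverage R O := by
      have e : Λ * (1 - 0.15 * ε) - L / t = (Λ * (t - t ^ 2 / 2) - L) / t := by
        rw [ht]; field_simp; ring
      rw [e, div_le_iff₀ ht0]
      linarith
    have hz := le_of_tail_bound (z := y / opt) hε hερ hρ hc hL hΛ hΛ0 (by positivity) (by
      refine le_trans (mul_le_mul_of_nonneg_left (mul_le_mul_of_nonneg_left h5 hρ0)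
        (by positivity)) (h3.trans (le_of_eq ?_))
      rw [← hg, hΛ_def]
      field_simp)
    rwa [le_div_iff₀ hopt0] at hz
  have hsub : prob (iidSamples (rrSample M) θ) (fun R => ¬ (ρ - ε) * opt ≤
      expectedInfluence M (selectSeeds m k δ arrival R)) ≤
      prob (iidSamples (rrSample M) θ) (fun R => (∃ S ∈ smallSets V k,
        θ * (influence M S / n) * g + (3 / 2 * c + L) ≤ 3 * ε * coverage R S) ∨
        -(Λ * (1 - Real.exp (-t)) - L) ≤ -t * coverage R O) := by
    refine prob_mono _ fun R hR => ?_
    by_contra hno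
    push Not at hno
    exact hR (hdet R (fun S hS => (hno.1 S hS).le) (by linarith [hno.2]))
  refine hsub.trans ((prob_or_le _ _ _).trans ?_)
  have hhalf : ENNReal.ofReal η = ENNReal.ofReal (η / 2) + ENNReal.ofReal (η / 2) := by
    rw [← ENNReal.ofReal_add (by positivity) (by positivity), add_halves]
  rw [hhalf]
  refine add_le_add ?_ ?_
  · refine (prob_exists_le _ _ _).trans ((Finset.sum_le_card_nsmul _ _
      (ENNReal.ofReal (Real.exp (-(3 / 2 * c)) * Real.exp (-L))) fun S _ => ?_).trans ?_)
    · refine (prob_le_coverage_le M S θ _ _).trans (le_of_eq ?_)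
      rw [← Real.exp_add]
      congr 2
      ring
    · rw [nsmul_eq_mul, ← ENNReal.ofReal_natCast, ← ENNReal.ofReal_mul (Nat.cast_nonneg _), hexpL]
      refine ENNReal.ofReal_le_ofReal ?_
      rw [← mul_assoc]
      refine mul_le_of_le_one_left (by positivity) ?_
      rw [Real.exp_neg, ← div_eq_mul_inv, div_le_one (Real.exp_pos _)]
      exact card_smallSets_le_exp V hk hkn
  · refine (prob_le_coverage_le M O θ _ _).trans (le_of_eq ?_)
    rw [← hexpL, hOopt, hΛ_def]
    congr 2
    ring

/-- The final samples are good with high probability. -/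
lemma prob_finalSamples_le (hk : 1 ≤ k) (hkn : 2 * k ≤ Fintype.card V) {ε η : ℝ}
    (hδ : 0 < δ) (hδ' : δ < 1 / 2) (hε : 0 < ε) (hη : 0 < η) (hη' : η < 1)
    (harrival : ∀ R part L, (arrival R part L).Perm L) :
    prob (finalSamples M m k δ ε η arrival) (fun R => ¬ (ratio δ - ε) * optInfluence M k ≤
      expectedInfluence M (selectSeeds m k δ arrival R)) ≤ ENNReal.ofReal η := by
  classical
  have hhalf : ENNReal.ofReal η = ENNReal.ofReal (η / 2) + ENNReal.ofReal (η / 2) := by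
    rw [← ENNReal.ofReal_add (by positivity) (by positivity), add_halves]
  rw [finalSamples, prob_bind, hhalf]
  -- A wrong LB is charged in full. For a correct one, ⌈λ*/LB⌉ samples are at least λ*/OPT, and
  -- fresh.
  refine le_trans (expect_mono _ (g := fun LB =>
    (if ¬ (0 < LB ∧ LB ≤ optInfluence M k) then 1 else 0) + ENNReal.ofReal (η / 2))
    fun LB => ?_) ?_
  · split_ifs with h
    · obtain ⟨h0, h1⟩ := h
      rw [zero_add]
      refine prob_not_le_expectedInfluence M arrival hk hkn hδ hδ' hε (half_pos hη) (by linarith)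
        harrival _ (le_trans ?_ (Nat.le_ceil _))
      refine div_le_div_of_nonneg_left ?_ h0 h1
      unfold lamStar; positivity
    · exact (prob_le_one _ _).trans le_self_add
  · rw [expect_add, expect_const]
    refine add_le_add_left ?_ _
    refine le_trans (le_of_eq ?_) (prob_lowerBound_le M hk hkn hδ hε (half_pos hη) (by linarith)
      arrival)
    unfold prob
    congr!

/-- The influence is counted as zero when LB is wrong, a loss of a factor 1 - η/2. Therefore the
mean guarantee with 0.84ε is used on the good event. -/
lemma le_expectedInfluence_greediRIS (hk : 1 ≤ k) (hkn : 2 * k ≤ Fintype.card V) {ε η : ℝ}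
    (hδ : 0 < δ) (hδ' : δ < 1 / 2) (hε : 0 < ε) (hη : 0 < η) (hη' : η < 1) (hηε : η ≤ ε)
    (harrival : ∀ R part L, (arrival R part L).Perm L) :
    (ratio δ - ε) * optInfluence M k ≤
      expectedInfluence M (greediRIS M m k δ ε η arrival) := by
  classical
  obtain ⟨hρ0, hρ⟩ := ratio_bounds hδ hδ'
  have hopt := one_le_optInfluence M hk
  have hopt0 : 0 < optInfluence M k := by linarith
  rcases le_or_gt (ratio δ) ε with hερ | hερ
  · exact (mul_nonpos_of_nonpos_of_nonneg (by linarith) hopt0.le).trans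
        (expectedInfluence_nonneg M _)
  rw [le_expectedInfluence_iff, greediRIS, finalSamples, expect_bind, expect_bind]
  have hgood : ENNReal.ofReal (1 - η / 2) ≤ prob (lowerBound M m k δ ε (η / 2) arrival)
      (fun LB => 0 < LB ∧ LB ≤ optInfluence M k) := by
    have h1 := prob_lowerBound_le M hk hkn hδ hε (half_pos hη) (by linarith) arrival
    rw [prob_not] at h1
    rw [ENNReal.ofReal_sub _ (half_pos hη).le, ENNReal.ofReal_one]
    exact tsub_le_iff_tsub_le.1 h1
  set B := (ratio δ - 0.84 * ε) * optInfluence M k with hB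
  have hB0 : 0 ≤ B := mul_nonneg (by linarith) hopt0.le
  calc ENNReal.ofReal ((ratio δ - ε) * optInfluence M k)
      ≤ ENNReal.ofReal (B * (1 - η / 2)) := by
        refine ENNReal.ofReal_le_ofReal ?_
        -- The loss is at most ρη/2 ≤ 0.14ε, within the spare 0.16ε; here η ≤ ε enters.
        have h1 : ratio δ - ε ≤ (ratio δ - 0.84 * ε) * (1 - η / 2) := by nlinarith
        have h2 := mul_le_mul_of_nonneg_right h1 hopt0.le
        rw [hB]; linarith
    _ = ENNReal.ofReal B * ENNReal.ofReal (1 - η / 2) := ENNReal.ofReal_mul hB0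
    _ ≤ ENNReal.ofReal B * prob (lowerBound M m k δ ε (η / 2) arrival)
      (fun LB => 0 < LB ∧ LB ≤ optInfluence M k) := mul_le_mul_right hgood _
    _ ≤ _ := by
        unfold prob
        rw [← expect_const_mul]
        refine expect_mono _ fun LB => ?_
        split_ifs with h
        · rw [mul_one]
          refine le_expect_influence M arrival hk hkn hδ hδ' hε hερ (half_pos hη) (by linarith)
            harrival _ (le_trans ?_ (Nat.le_ceil _))
          refine div_le_div_of_nonneg_left ?_ h.1 h.2
          unfold lamStar; positivity
        · simp

end Guarantee

end GreediRIS

end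

/-! ### The approximation theorem. -/

theorem mainTheorem2 {V : Type*} [Fintype V] [LinearOrder V] [Nonempty V] {G : Digraph V}
    (M : GreediRIS.DiffusionModel G) (m k : ℕ) [NeZero m] (hk : 1 ≤ k)
    (hkn : 2 * k ≤ Fintype.card V) (δ ε η : ℝ) (hδ : 0 < δ) (hδ' : δ < 1 / 2) (hε : 0 < ε)
    (hη : 0 < η) (hη' : η < 1)
    (arrival : List (Finset V) → (V → Fin m) → List V → List V)
    (harrival : ∀ R part L, (arrival R part L).Perm L) :
    (∀ θ : ℕ, GreediRIS.lamStar (Fintype.card V) k ε η / GreediRIS.optInfluence M k ≤ θ →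
      (GreediRIS.ratio δ - ε) * GreediRIS.optInfluence M k ≤
        GreediRIS.expectedInfluence M
          ((GreediRIS.iidSamples (GreediRIS.rrSample M) θ).bind
            (GreediRIS.selectSeeds m k δ arrival)) ∧
      1 - η ≤ ((GreediRIS.iidSamples (GreediRIS.rrSample M) θ).toOuterMeasure
        {R | (GreediRIS.ratio δ - ε) * GreediRIS.optInfluence M k ≤
          GreediRIS.expectedInfluence M (GreediRIS.selectSeeds m k δ arrival R)}).toReal) ∧
    (∀ S ∈ (GreediRIS.greediRIS M m k δ ε η arrival).support, S.card ≤ k) ∧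
    1 - η ≤ ((GreediRIS.finalSamples M m k δ ε η arrival).toOuterMeasure
      {R | (GreediRIS.ratio δ - ε) * GreediRIS.optInfluence M k ≤
        GreediRIS.expectedInfluence M (GreediRIS.selectSeeds m k δ arrival R)}).toReal ∧
    (η ≤ ε →
      (GreediRIS.ratio δ - ε) * GreediRIS.optInfluence M k ≤
        GreediRIS.expectedInfluence M (GreediRIS.greediRIS M m k δ ε η arrival)) := by

  refine ⟨fun θ hθ => ⟨?_, ?_⟩, ?_, ?_, fun hηε => ?_⟩
  · rcases le_or_gt (GreediRIS.ratio δ) ε with hερ | hερ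
    · exact (mul_nonpos_of_nonpos_of_nonneg (by linarith)
        (zero_le_one.trans (GreediRIS.one_le_optInfluence M hk))).trans
        (GreediRIS.expectedInfluence_nonneg M _)
    · rw [GreediRIS.le_expectedInfluence_iff, GreediRIS.expect_bind]
      refine le_trans (ENNReal.ofReal_le_ofReal ?_)
        (GreediRIS.le_expect_influence M arrival hk hkn hδ hδ' hε hερ hη hη' harrival θ hθ)
      exact mul_le_mul_of_nonneg_right (by linarith)
        (zero_le_one.trans (GreediRIS.one_le_optInfluence M hk))
  · exact GreediRIS.one_sub_le_toReal_toOuterMeasure _ _ hη.le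
      (GreediRIS.prob_not_le_expectedInfluence M arrival hk hkn hδ hδ' hε hη hη' harrival θ hθ)
  · intro S hS
    rw [GreediRIS.greediRIS, PMF.mem_support_bind_iff] at hS
    obtain ⟨R, -, hS⟩ := hS
    exact GreediRIS.card_le_of_mem_support_selectSeeds hδ arrival R S hS
  · exact GreediRIS.one_sub_le_toReal_toOuterMeasure _ _ hη.le
      (GreediRIS.prob_finalSamples_le M arrival hk hkn hδ hδ' hε hη hη' harrival)
  · exact GreediRIS.le_expectedInfluence_greediRIS M arrival hk hkn hδ hδ' hε hη hη' hηε harrival
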